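/- **Proposition (Oeljeklaus–Toma manifolds of type $(s,1)$).** Let $K$ be a number field with exactly $s\ge 1$ real embeddings $\sigma_1,\dots,\sigma_s$ and exactly $2t\ge 2$ non-real complex embeddings $\sigma_{s+1},\dots,\sigma_{s+t},\bar\sigma_{s+1},\dots,\bar\sigma_{s+t}$. Let $U$ be a subgroup of rank $s$ of the group $\mathcal O_K^{*}$ of units of the ring of integers $\mathcal O_K$ such that $\sigma_i(a)>0$ for all $a\in U$, $1\le i\le s$, and such that $\{(\log\sigma_1(a),\dots,\log\sigma_s(a)) : a\in U\}$ is a lattice in $\mathbb R^s$. Let $H\subset\mathbb C$ be the upper half-plane. The group $U\ltimes\mathcal O_K$ acts freely, properly discontinuously and holomorphically on $H^s\times\mathbb C^t$ by $$(a,b)\cdot(x_1,\dots,x_s,z_1,\dots,z_t)=\bigl(\sigma_1(a)x_1+\sigma_1(b),\dots,\sigma_s(a)x_s+\sigma_s(b),\ \sigma_{s+1}(a)z_1+\sigma_{s+1}(b),\dots,\sigma_{s+t}(a)z_t+\sigma_{s+t}(b)\bigr),$$ and the complex manifold $X(K,U)=(H^s\times\mathbb C^t)/(U\ltimes\mathcal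 O_K)$ is called an Oeljeklaus–Toma manifold of type $(s,t)$. A smooth Hermitian metric on a complex manifold is called SKT (strong Kähler with torsion) if its fundamental form $\Omega$ satisfies $dd^c\Omega=0$ (equivalently $\partial\bar\partial\Omega=0$), where $d^c=J^{-1}dJ$. Let $s\ge 2$ and let $M=X(K,U)$ be an Oeljeklaus–Toma manifold of type $(s,1)$. Then: 1. $M$ admits no SKT metric. 2. Let $c_1,\dots,c_s\in\mathbb R$ and let $G=\mathbb R^s\ltimes_\phi(\mathbb R^s\times\mathbb C)$ be the solvable Lie group with $$\phi(r_1,\dots,r_s)=\mathrm{diag}\bigl(e^{r_1},\dots,e^{r_s},e^{-\frac12(r_1+\dots+r_s)+\sqrt{-1}\,(c_1r_1+\dots+c_sr_s)}\bigr),$$ which acts simply transitively on $H^s\times\mathbb C$ by $(r,u,v)\cdot(x,z)=\phi(r)(x,z)+(u,v)$. Call a form on $M$ left-invariant if its lift to $H^s\times\mathbb C$ is $G$-invariant. Then every left-invariant complex-valued $(1,1)$-form on $M$ with $dd^c\Omega=0$ has no component along $w_{s+1}\wedge\bar w_{s+1}$, where $w_{s+1}$ is the left-invariant $(1,0)$-form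 proportional to $dz$; that is, the lift of $\Omega$ vanishes on every pair of vectors tangent to the factor $\mathbb C$. -/

import Mathlib

open scoped Manifold ContDiff Topology NumberField

noncomputable section

namespace ComplexManifold

section Forms

variable {E : Type*} [NormedAddCommGroup E] [NormedSpace ℝ E] [NormedSpace ℂ E]
  [IsScalarTower ℝ ℂ E]
  {F : Type*} [NormedAddCommGroup F] [NormedSpace ℝ F] {n : ℕ}

variable (E) in
/-- Multiplication by `i`, as a real-linear map. -/
def mulI : E →L[ℝ] E :=
  (Complex.I • ContinuousLinearMap.id ℂ E).restrictScalars ℝ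

/-- The operator `dᶜ = J⁻¹ d J` on differential forms on a complex vector space `E`, where `J` acts
on a form by `(J α)(v₁, …, vₙ) = α(J v₁, …, J vₙ)`. -/
def localDc (α : E → E [⋀^Fin n]→L[ℝ] F) : E → E [⋀^Fin (n + 1)]→L[ℝ] F := fun y ↦
  (extDeriv (fun z ↦ (α z).compContinuousLinearMap (mulI E)) y).compContinuousLinearMap (-mulI E)

/-- The operator `d dᶜ` on differential forms on a complex vector space. -/
def localDdc (α : E → E [⋀^Fin n]→L[ℝ] F) : E → E [⋀^Fin (n + 2)]→L[ℝ] F :=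
  extDeriv (localDc α)

end Forms

section Manifold

/-- A complex manifold is in particular a smooth real manifold (with the same charts). -/
instance isManifold_real {E : Type*} [NormedAddCommGroup E] [NormedSpace ℝ E] [NormedSpace ℂ E]
    [IsScalarTower ℝ ℂ E] {M : Type*} [TopologicalSpace M] [ChartedSpace E M]
    [IsManifold 𝓘(ℂ, E) ω M] : IsManifold 𝓘(ℝ, E) ∞ M := by
  refine isManifold_of_contDiffOn _ _ _ fun e e' he he' ↦ ?_
  have h := (contDiffGroupoid ω 𝓘(ℂ, E)).compatible he he'
  rw [contDiffGroupoid, mem_groupoid_of_pregroupoid] at h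
  have h1 : ContDiffOn ℂ ω _ _ := h.1
  exact (h1.restrict_scalars ℝ).of_le le_top

variable (E : Type*) [NormedAddCommGroup E] [NormedSpace ℝ E] [NormedSpace ℂ E]
  [IsScalarTower ℝ ℂ E] (M : Type*) [TopologicalSpace M] [ChartedSpace E M]
  (F : Type*) [NormedAddCommGroup F] [NormedSpace ℝ F]

/-- Differential `n`-forms with values in `F` on a manifold `M` modelled on the complex
vector space `E`, as fields of alternating real-multilinear maps on the tangent spaces. -/
abbrev DForm (n : ℕ) : Type _ := ∀ x : M, TangentSpace 𝓘(ℝ, E) x [⋀^Fin n]→L[ℝ] F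

variable {M} in
/-- The complex structure on the tangent spaces of a complex manifold. Mathlib identifies
`TangentSpace 𝓘(ℝ, E) x` with `E` through the preferred chart at `x`. -/
def J (x : M) : TangentSpace 𝓘(ℝ, E) x →L[ℝ] TangentSpace 𝓘(ℝ, E) x := mulI E

variable {E M F} {n : ℕ}

/-- The pullback of a differential form. -/
def DForm.pullback {E' : Type*} [NormedAddCommGroup E'] [NormedSpace ℝ E']
    {N : Type*} [TopologicalSpace N] [ChartedSpace E' N]
    (f : N → M) (η : DForm E M F n) : DForm E' N F n := fun x ↦
  (η (f x)).compContinuousLinearMap (mfderiv 𝓘(ℝ, E') 𝓘(ℝ, E) f x)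

/-- The operator `d dᶜ` on differential forms on a complex manifold, computed at each point in the
preferred chart at this point (it does not depend on the choice of the holomorphic chart). -/
def DForm.ddc (η : DForm E M F n) : DForm E M F (n + 2) := fun x ↦
  (localDdc (E := E) (DForm.pullback (E' := E) (chartAt E x).symm η) (chartAt E x x) :
    E [⋀^Fin (n + 2)]→L[ℝ] F)

/-- A `2`-form is of type `(1,1)` if it is invariant under the complex structure. -/
def DForm.IsOneOne (η : DForm E M F 2) : Prop :=
  ∀ (x : M) (v w : TangentSpace 𝓘(ℝ, E) x), η x ![J E x v, J E x w] = η x ![v, w]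

variable (E M) in
/-- A (smooth) Hermitian metric on a complex manifold: a smooth Riemannian metric for which
the complex structure is an isometry. -/
structure HermitianMetric [IsManifold 𝓘(ℂ, E) ω M] extends
    Bundle.ContMDiffRiemannianMetric 𝓘(ℝ, E) ∞ E (fun x : M ↦ TangentSpace 𝓘(ℝ, E) x) where
  inner_J : ∀ (x : M) (v w : TangentSpace 𝓘(ℝ, E) x),
    inner x (J E x v) (J E x w) = inner x v w

lemma J_J (x : M) (v : TangentSpace 𝓘(ℝ, E) x) : J E x (J E x v) = -v := by
  change (Complex.I • (Complex.I • (show E from v)) : E) = -(show E from v)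
  rw [smul_smul, Complex.I_mul_I, neg_one_smul]

/-- The fundamental form `Ω(v, w) = g(J v, w)` of a Hermitian metric. -/
def HermitianMetric.fundamentalForm [IsManifold 𝓘(ℂ, E) ω M] (g : HermitianMetric E M) :
    DForm E M ℝ 2 := fun x ↦
  { toFun := fun v ↦ g.inner x (J E x (v 0)) (v 1)
    map_update_add' := by
      intro _ m i v w
      fin_cases i <;> simp
    map_update_smul' := by
      intro _ m i c v
      fin_cases i <;> simp
    cont := by
      fun_prop
    map_eq_zero_of_eq' := by
      intro v i j hv hij
      have h01 : v 0 = v 1 := by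
        fin_cases i <;> fin_cases j <;> simp_all
      have h := g.inner_J x (J E x (v 0)) (v 0)
      rw [J_J, map_neg, neg_apply, g.symm] at h
      rw [← h01]
      linarith }

lemma HermitianMetric.fundamentalForm_apply [IsManifold 𝓘(ℂ, E) ω M] (g : HermitianMetric E M)
    (x : M) (v w : TangentSpace 𝓘(ℝ, E) x) :
    g.fundamentalForm x ![v, w] = g.inner x (J E x v) w := rfl

/-- A Hermitian metric is strong Kähler with torsion (SKT) if its fundamental form is
`∂∂̄`-closed, i.e. `d dᶜ`-closed (since `d dᶜ = 2i ∂∂̄` up to sign). -/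
def HermitianMetric.IsSKT [IsManifold 𝓘(ℂ, E) ω M] (g : HermitianMetric E M) : Prop :=
  g.fundamentalForm.ddc = 0

end Manifold

end ComplexManifold

namespace OeljeklausToma

open ComplexManifold

section Construction

set_option linter.unusedSectionVars false

variable {K : Type*} [Field K] [NumberField K] {s t : ℕ}

/-- The first `s` coordinates of the logarithmic embedding:
`a ↦ (log |σ₁(a)|, …, log |σ_s(a)|)`. -/
def logProj (σ : Fin s → K →+* ℝ) : Additive (𝓞 K)ˣ →+ (Fin s → ℝ) where
  toFun a := fun i ↦ Real.log |σ i ((a.toMul : 𝓞 K) : K)|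
  map_zero' := by
    funext i
    simp
  map_add' a b := by
    funext i
    have h : ∀ c : (𝓞 K)ˣ, |σ i ((c : 𝓞 K) : K)| ≠ 0 := fun c ↦ by simp
    simp only [toMul_add, Units.val_mul, map_mul, abs_mul, Pi.add_apply]
    exact Real.log_mul (h _) (h _)

variable (K s t) in
/-- The data from which an Oeljeklaus–Toma manifold `X(K, U)` of type `(s, t)` is built. -/
structure Datum where
  /-- The real embeddings `σ₁, …, σ_s`. -/
  σ : Fin s → K →+* ℝ
  /-- The complex embeddings `σ_{s+1}, …, σ_{s+t}`, one from each pair of conjugate ones. -/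
  τ : Fin t → K →+* ℂ
  s_pos : 0 < s
  t_pos : 0 < t
  /-- Together with the conjugates of the `τ j`, these are all the embeddings of `K` in `ℂ`, each
  of them listed once. In particular `[K : ℚ] = s + 2t`. -/
  bijective : Function.Bijective
    (Sum.elim (fun i ↦ Complex.ofRealHom.comp (σ i))
      (Sum.elim τ (fun j ↦ (starRingEnd ℂ).comp (τ j))) : Fin s ⊕ (Fin t ⊕ Fin t) → (K →+* ℂ))
  /-- The group of units `U`. -/
  U : Subgroup (𝓞 K)ˣ
  U_pos : ∀ a ∈ U, ∀ i, 0 < σ i ((a : 𝓞 K) : K)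
  rank_U : Module.finrank ℤ (Additive U) = s
  /-- The image of `U` in `ℝˢ` is a lattice: it is discrete and spans `ℝˢ`. -/
  discrete : DiscreteTopology ((Subgroup.toAddSubgroup U).map (logProj σ))
  span : Submodule.span ℝ ((Subgroup.toAddSubgroup U).map (logProj σ) : Set (Fin s → ℝ)) = ⊤

variable (s t) in
/-- The complex vector space `ℂˢ × ℂᵗ`. -/
abbrev Model : Type := (Fin s → ℂ) × (Fin t → ℂ)

variable (s t) in
/-- The domain `Hˢ × ℂᵗ`, where `H` is the upper half-plane. -/
def domain : TopologicalSpace.Opens (Model s t) where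
  carrier := {p | ∀ i, 0 < (p.1 i).im}
  is_open' := by
    simp only [Set.ofPred_forall]
    exact isOpen_iInter_of_finite fun i ↦ isOpen_lt continuous_const (by fun_prop)

/-- The action of a group of units on the additive group of integers, by multiplication. -/
def unitsAct (U : Subgroup (𝓞 K)ˣ) : U →* MulAut (Multiplicative (𝓞 K)) where
  toFun a := (DistribMulAction.toAddEquiv (𝓞 K) (a : (𝓞 K)ˣ)).toMultiplicative
  map_one' := by
    ext b
    simp
  map_mul' a b := by
    ext c
    simp [mul_smul]

/-- The group `U ⋉ 𝓞 K`, with `(b, a) (b', a') = (b + a b', a a')`. -/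
def Datum.Γ (X : Datum K s t) : Type _ := Multiplicative (𝓞 K) ⋊[unitsAct X.U] X.U

instance (X : Datum K s t) : Group X.Γ :=
  inferInstanceAs (Group (Multiplicative (𝓞 K) ⋊[unitsAct X.U] X.U))

/-- The component in `U` of an element of `U ⋉ 𝓞 K`. -/
def Datum.Γ.unit {X : Datum K s t} (g : X.Γ) : (𝓞 K)ˣ :=
  (SemidirectProduct.right (φ := unitsAct X.U) g : X.U)

/-- The component in `𝓞 K` of an element of `U ⋉ 𝓞 K`. -/
def Datum.Γ.int {X : Datum K s t} (g : X.Γ) : 𝓞 K :=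
  (SemidirectProduct.left (φ := unitsAct X.U) g).toAdd

lemma Datum.Γ.unit_mem {X : Datum K s t} (g : X.Γ) : g.unit ∈ X.U :=
  (SemidirectProduct.right (φ := unitsAct X.U) g).2

@[simp] lemma Datum.Γ.unit_one {X : Datum K s t} : (1 : X.Γ).unit = 1 := rfl

@[simp] lemma Datum.Γ.int_one {X : Datum K s t} : (1 : X.Γ).int = 0 := rfl

@[simp] lemma Datum.Γ.unit_mul {X : Datum K s t} (g h : X.Γ) :
    (g * h).unit = g.unit * h.unit := rfl

@[simp] lemma Datum.Γ.int_mul {X : Datum K s t} (g h : X.Γ) :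
    (g * h).int = g.int + (g.unit : 𝓞 K) * h.int := rfl

lemma Datum.Γ.ext {X : Datum K s t} {g h : X.Γ} (h1 : g.int = h.int) (h2 : g.unit = h.unit) :
    g = h :=
  SemidirectProduct.ext h1 (Subtype.ext h2)

/-- The affine transformation of `ℂˢ × ℂᵗ` given by an element of `U ⋉ 𝓞 K`. -/
def Datum.affine (X : Datum K s t) (g : X.Γ) (p : Model s t) : Model s t :=
  (fun i ↦ (X.σ i ((g.unit : 𝓞 K) : K) : ℂ) * p.1 i +
      (X.σ i (g.int : K) : ℂ),
    fun j ↦ X.τ j ((g.unit : 𝓞 K) : K) * p.2 j + X.τ j (g.int : K))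

lemma Datum.affine_mem (X : Datum K s t) (g : X.Γ) {p : Model s t} (hp : p ∈ domain s t) :
    X.affine g p ∈ domain s t := fun i ↦ by
  simpa [Datum.affine] using mul_pos (X.U_pos _ g.unit_mem i) (hp i)

/-- The action of `U ⋉ 𝓞 K` on `Hˢ × ℂᵗ`. -/
instance Datum.smul (X : Datum K s t) : SMul X.Γ (domain s t) where
  smul g p := ⟨X.affine g p, X.affine_mem g p.2⟩

instance Datum.action (X : Datum K s t) : MulAction X.Γ (domain s t) where
  one_smul p := by
    refine Subtype.ext ?_
    change X.affine 1 p = p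
    ext i <;> simp [Datum.affine]
  mul_smul g h p := by
    refine Subtype.ext ?_
    change X.affine (g * h) p = X.affine g (X.affine h p)
    ext i <;> simp [Datum.affine] <;> ring

lemma Datum.coe_smul (X : Datum K s t) (g : X.Γ) (p : domain s t) :
    ((g • p : domain s t) : Model s t) = X.affine g p := rfl

lemma Datum.contDiff_affine (X : Datum K s t) (g : X.Γ) : ContDiff ℂ ω (X.affine g) := by
  unfold Datum.affine
  fun_prop

instance Datum.continuousConstSMul (X : Datum K s t) : ContinuousConstSMul X.Γ (domain s t) where
  continuous_const_smul g :=
    Continuous.subtype_mk ((X.contDiff_affine g).continuous.comp continuous_subtype_val) _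

lemma Datum.eq_one_of_σ (X : Datum K s t) {a : (𝓞 K)ˣ} {i : Fin s}
    (h : X.σ i ((a : 𝓞 K) : K) = 1) : a = 1 := by
  have h1 : ((a : 𝓞 K) : K) = 1 := (X.σ i).injective (by rw [h, map_one])
  exact Units.ext (NumberField.RingOfIntegers.ext (by simpa using h1))

instance Datum.isCancelSMul (X : Datum K s t) : IsCancelSMul X.Γ (domain s t) := by
  refine isCancelSMul_iff_eq_one_of_smul_eq.mpr fun g p h ↦ ?_
  have h' : X.affine g p = p := congrArg Subtype.val h
  let i : Fin s := ⟨0, X.s_pos⟩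
  have h1 := congrFun (congrArg Prod.fst h') i
  have h2 := congrArg Complex.im h1
  have hp : 0 < (p.1.1 i).im := p.2 i
  simp only [Datum.affine, Complex.add_im, Complex.im_ofReal_mul,
    Complex.ofReal_im, add_zero] at h2
  have ha : g.unit = 1 := X.eq_one_of_σ (i := i) (by
    exact mul_right_cancel₀ hp.ne' (by rw [h2, one_mul]))
  have hb : (X.σ i (g.int : K) : ℂ) = 0 := by
    simpa [Datum.affine, ha] using h1
  have hb' : (g.int : K) = 0 := by simpa using hb
  exact Datum.Γ.ext (NumberField.RingOfIntegers.ext hb') ha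

lemma Datum.logProj_injOn (X : Datum K s t) {a : (𝓞 K)ˣ} (ha : a ∈ X.U)
    (h : logProj X.σ (Additive.ofMul a) = 0) : a = 1 := by
  let f : Additive X.U →ₗ[ℤ] (Fin s → ℝ) :=
    ((logProj X.σ).comp (MonoidHom.toAdditive X.U.subtype)).toIntLinearMap
  have hf : (LinearMap.range f : Set (Fin s → ℝ)) =
      ((Subgroup.toAddSubgroup X.U).map (logProj X.σ) : Set (Fin s → ℝ)) := by
    ext x
    constructor
    · rintro ⟨b, rfl⟩
      exact ⟨Additive.ofMul (b.toMul : (𝓞 K)ˣ), b.toMul.2, rfl⟩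
    · rintro ⟨b, hb, rfl⟩
      exact ⟨Additive.ofMul ⟨b.toMul, hb⟩, rfl⟩
  have hd : IsDiscrete (LinearMap.range f : Set (Fin s → ℝ)) := by
    rw [hf]
    exact isDiscrete_iff_discreteTopology.mpr X.discrete
  have : DiscreteTopology (LinearMap.range f) := isDiscrete_iff_discreteTopology.mp hd
  have : IsZLattice ℝ (LinearMap.range f) := ⟨by rw [hf]; exact X.span⟩
  have h1 : Module.finrank ℤ (LinearMap.range f) = s := by
    rw [ZLattice.rank ℝ, Module.finrank_fin_fun]
  have : Module.Finite ℤ (Additive X.U) := by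
    refine Module.Finite.of_injective (MonoidHom.toAdditive X.U.subtype).toIntLinearMap ?_
    intro b c hbc
    exact Subtype.ext hbc
  have h2 := Submodule.finrank_quotient_add_finrank (LinearMap.ker f)
  rw [f.quotKerEquivRange.finrank_eq, h1, X.rank_U] at h2
  have h3 : Module.finrank ℤ (LinearMap.ker f) = 0 := by omega
  rw [Module.finrank_eq_zero_iff] at h3
  obtain ⟨n, hn, hna⟩ := h3 ⟨Additive.ofMul ⟨a, ha⟩, h⟩
  have h4 : n • (Additive.ofMul (⟨a, ha⟩ : X.U)) = 0 := congrArg Subtype.val hna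
  have h5 : a ^ n = 1 := congrArg (fun x : Additive X.U ↦ (x.toMul : (𝓞 K)ˣ)) h4
  have h6 : a ^ n.natAbs = 1 := by
    rcases Int.natAbs_eq n with h | h <;> rw [h] at h5 <;> simpa using h5
  let i : Fin s := ⟨0, X.s_pos⟩
  have h7 : X.σ i ((a : 𝓞 K) : K) ^ n.natAbs = 1 := by
    rw [← map_pow, ← map_pow, ← Units.val_pow_eq_pow_val, h6]
    simp
  exact X.eq_one_of_σ (i := i)
    ((pow_eq_one_iff_of_nonneg (X.U_pos a ha i).le (Int.natAbs_ne_zero.mpr hn)).mp h7)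

lemma Datum.finite_units (X : Datum K s t) (B : ℝ) :
    {a : X.U | ∀ i, abs (logProj X.σ (Additive.ofMul (a : (𝓞 K)ˣ)) i) ≤ B}.Finite := by
  have := X.discrete
  have h1 : (Metric.closedBall (0 : Fin s → ℝ) B ∩
      ((Subgroup.toAddSubgroup X.U).map (logProj X.σ) : Set (Fin s → ℝ))).Finite :=
    Metric.finite_isBounded_inter_isClosed (isDiscrete_iff_discreteTopology.mpr X.discrete)
      Metric.isBounded_closedBall AddSubgroup.isClosed_of_discrete
  refine Set.Finite.of_finite_image (f := fun a : X.U ↦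
    logProj X.σ (Additive.ofMul (a : (𝓞 K)ˣ))) (h1.subset ?_) ?_
  · rintro _ ⟨a, ha, rfl⟩
    refine ⟨?_, ⟨_, a.2, rfl⟩⟩
    have hB : 0 ≤ B := (abs_nonneg _).trans (ha ⟨0, X.s_pos⟩)
    rw [mem_closedBall_zero_iff, pi_norm_le_iff_of_nonneg hB]
    exact ha
  · intro a _ b _ hab
    have h2 : ((a / b : X.U) : (𝓞 K)ˣ) = 1 := by
      refine X.logProj_injOn (a / b).2 ?_
      have hab' : logProj X.σ (Additive.ofMul (a : (𝓞 K)ˣ)) =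
        logProj X.σ (Additive.ofMul (b : (𝓞 K)ˣ)) := hab
      rw [Subgroup.coe_div, ofMul_div, map_sub, hab', sub_self]
    exact div_eq_one.mp (Subtype.ext h2)

instance Datum.properlyDiscontinuousSMul (X : Datum K s t) :
    ProperlyDiscontinuousSMul X.Γ (domain s t) := by
  refine ⟨fun {A B} hA hB ↦ ?_⟩
  have hC : IsCompact (A ∪ B) := hA.union hB
  obtain ⟨R, hR⟩ : ∃ R, ∀ p ∈ A ∪ B, ‖(p : Model s t)‖ ≤ R :=
    (hC.exists_bound_of_continuousOn continuous_subtype_val.continuousOn)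
  obtain ⟨R', hR'⟩ : ∃ R', ∀ p ∈ A ∪ B,
      ‖(fun i ↦ Real.log ((p : Model s t).1 i).im : Fin s → ℝ)‖ ≤ R' := by
    refine hC.exists_bound_of_continuousOn (Continuous.continuousOn ?_)
    refine continuous_pi fun i ↦ ?_
    refine Continuous.log ?_ fun p ↦ (p.2 i).ne'
    exact Complex.continuous_im.comp
      ((continuous_apply i).comp (continuous_fst.comp continuous_subtype_val))
  have hfin := X.finite_units (2 * R')
  have hint : ∀ a : X.U, {b : 𝓞 K | ∀ φ : K →+* ℂ, ‖φ (b : K)‖ ≤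
      R + ‖φ ((((a : (𝓞 K)ˣ) : 𝓞 K)) : K)‖ * R}.Finite := by
    intro a
    obtain ⟨M, hM⟩ := Finite.exists_le
      (fun φ : K →+* ℂ ↦ R + ‖φ ((((a : (𝓞 K)ˣ) : 𝓞 K)) : K)‖ * R)
    refine Set.Finite.of_finite_image (f := fun b : 𝓞 K ↦ (b : K))
      ((NumberField.Embeddings.finite_of_norm_le K ℂ M).subset ?_)
      (NumberField.RingOfIntegers.coe_injective.injOn)
    rintro _ ⟨b, hb, rfl⟩
    exact ⟨NumberField.RingOfIntegers.isIntegral_coe b, fun φ ↦ (hb φ).trans (hM φ)⟩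
  refine ((hfin.biUnion fun a _ ↦ (hint a).image fun b ↦
    ((⟨Multiplicative.ofAdd b, a⟩ : Multiplicative (𝓞 K) ⋊[unitsAct X.U] X.U) : X.Γ))).subset ?_
  rintro (g : X.Γ) ⟨_, ⟨p, hpA, rfl⟩, hgp⟩
  have hp : p ∈ A ∪ B := Or.inl hpA
  have hq : g • p ∈ A ∪ B := Or.inr hgp
  refine Set.mem_biUnion (x := (⟨g.unit, g.unit_mem⟩ : X.U)) ?_ ⟨g.int, ?_, rfl⟩
  · intro i
    have e1 : (((g • p : domain s t) : Model s t).1 i).im =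
        X.σ i ((g.unit : 𝓞 K) : K) * ((p : Model s t).1 i).im := by
      simp [Datum.coe_smul, Datum.affine]
    have hpos := X.U_pos _ g.unit_mem i
    have e2 : Real.log |X.σ i ((g.unit : 𝓞 K) : K)| =
        Real.log (((g • p : domain s t) : Model s t).1 i).im -
          Real.log ((p : Model s t).1 i).im := by
      have hpi : 0 < ((p : Model s t).1 i).im := p.2 i
      rw [e1, Real.log_mul hpos.ne' hpi.ne', abs_of_pos hpos]
      ring
    have b1 := (norm_le_pi_norm (fun i ↦ Real.log ((p : Model s t).1 i).im) i).trans (hR' p hp)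
    have b2 := (norm_le_pi_norm
      (fun i ↦ Real.log (((g • p : domain s t) : Model s t).1 i).im) i).trans (hR' _ hq)
    rw [Real.norm_eq_abs] at b1 b2
    change abs (Real.log |X.σ i ((g.unit : 𝓞 K) : K)|) ≤ 2 * R'
    rw [e2]
    rw [abs_le] at b1 b2 ⊢
    constructor <;> linarith
  · have key : ∀ (φ : K →+* ℂ) (z z' : ℂ), ‖z‖ ≤ R → ‖z'‖ ≤ R →
        z' = φ ((g.unit : 𝓞 K) : K) * z + φ (g.int : K) →
        ‖φ (g.int : K)‖ ≤ R + ‖φ ((g.unit : 𝓞 K) : K)‖ * R := by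
      intro φ z z' hz hz' h
      have : φ (g.int : K) = z' - φ ((g.unit : 𝓞 K) : K) * z := by rw [h]; ring
      rw [this]
      refine (norm_sub_le _ _).trans ?_
      rw [norm_mul]
      gcongr
    intro φ
    obtain ⟨k, rfl⟩ := X.bijective.2 φ
    have n1 : ∀ (p : domain s t), p ∈ A ∪ B → ∀ i, ‖(p : Model s t).1 i‖ ≤ R := fun p hp i ↦
      (norm_le_pi_norm _ i).trans ((norm_fst_le _).trans (hR p hp))
    have n2 : ∀ (p : domain s t), p ∈ A ∪ B → ∀ j, ‖(p : Model s t).2 j‖ ≤ R := fun p hp j ↦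
      (norm_le_pi_norm _ j).trans ((norm_snd_le _).trans (hR p hp))
    rcases k with i | j | j
    · exact key _ _ _ (n1 p hp i) (n1 _ hq i) rfl
    · exact key _ _ _ (n2 p hp j) (n2 _ hq j) rfl
    · have := key (X.τ j) _ _ (n2 p hp j) (n2 _ hq j) rfl
      simpa using this

instance : LocallyCompactSpace (domain s t) :=
  (domain s t).isOpen.locallyCompactSpace

/-- The Oeljeklaus–Toma manifold `X(K, U) = (Hˢ × ℂᵗ) / (U ⋉ 𝓞 K)`, the orbit space. -/
abbrev Datum.Manifold (X : Datum K s t) : Type := MulAction.orbitRel.Quotient X.Γ (domain s t)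

/-- The projection `Hˢ × ℂᵗ → X(K, U)`. -/
def Datum.proj (X : Datum K s t) : domain s t → X.Manifold := Quotient.mk _

/-- `X(K, U)` is a complex manifold; its charts, given by Mathlib's charted space structure on a
quotient by a free and properly discontinuous action, are local inverses of the projection. -/
instance Datum.isManifold (X : Datum K s t) : IsManifold 𝓘(ℂ, Model s t) ω X.Manifold := by
  refine isManifold_of_contDiffOn _ _ _ fun e e' he he' ↦ ?_
  obtain ⟨q, rfl⟩ := he
  obtain ⟨q', rfl⟩ := he'
  have hcov : IsQuotientCoveringMap X.proj X.Γ :=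
    isQuotientCoveringMap_quotientMk_of_properlyDiscontinuousSMul
  have hloc : IsLocalHomeomorph X.proj := hcov.isCoveringMap.isLocalHomeomorph
  let r : X.Manifold → domain s t := Quotient.mk_surjective.hasRightInverse.choose
  let L := hloc.localInverseAt (r q)
  let L' := hloc.localInverseAt (r q')
  let c := chartAt (Model s t) (r q)
  let c' := chartAt (Model s t) (r q')
  change ContDiffOn ℂ ω ((L.trans c).symm.trans (L'.trans c'))
    (((L.trans c).symm.trans (L'.trans c')).source ∩ Set.range id)
  have hc : ∀ z ∈ c.target, (c.symm z : Model s t) = z := fun z hz ↦ c.right_inv hz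
  have hc' : ∀ p, c' p = (p : Model s t) := fun p ↦ rfl
  have hL' : ∀ x ∈ L'.source, X.proj (L' x) = x := fun x hx ↦
    hloc.apply_localInverseAt_of_mem hx
  have hLs : ∀ p, L.symm p = X.proj p := fun p ↦
    congrFun (hloc.localInverseAt_symm (x := r q)) p
  rintro z ⟨hz, -⟩
  refine ContDiffAt.contDiffWithinAt ?_
  have hz1 : z ∈ c.target := by
    have := hz.1
    exact this.1
  have hz2 : X.proj (c.symm z) ∈ L'.source := by
    have := hz.2.1
    rw [← hLs]
    exact this
  have hfib : X.proj (L' (X.proj (c.symm z))) = X.proj (c.symm z) := hL' _ hz2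
  obtain ⟨g, hg⟩ := hcov.apply_eq_iff_mem_orbit.mp hfib
  have hg' : g • c.symm z = L' (X.proj (c.symm z)) := hg
  have hev : ∀ᶠ z' in 𝓝 z, ((L.trans c).symm.trans (L'.trans c')) z' = X.affine g z' := by
    have hcont : ContinuousAt (fun z' ↦ g • c.symm z') z :=
      (c.symm.continuousAt hz1).const_smul g
    have hmem : g • c.symm z ∈ L'.target := by
      rw [hg']
      exact L'.map_source hz2
    filter_upwards [hcont.eventually (L'.open_target.mem_nhds hmem),
      c.open_target.mem_nhds hz1] with z' h1 h2
    have h3 : X.proj (c.symm z') = L'.symm (g • c.symm z') := by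
      rw [congrFun (hloc.localInverseAt_symm (x := r q'))]
      exact (hcov.apply_eq_iff_mem_orbit.mpr ⟨g, rfl⟩).symm
    change c' (L' (L.symm (c.symm z'))) = _
    rw [hLs, h3, L'.right_inv h1, hc', Datum.coe_smul, hc z' h2]
  exact (X.contDiff_affine g).contDiffAt.congr_of_eventuallyEq hev

/-- The lift to `Hˢ × ℂᵗ` of a differential form on `X(K, U)`. -/
def Datum.lift (X : Datum K s t) {F : Type*} [NormedAddCommGroup F] [NormedSpace ℝ F] {n : ℕ}
    (η : DForm (Model s t) X.Manifold F n) : DForm (Model s t) (domain s t) F n :=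
  DForm.pullback (E := Model s t) (E' := Model s t) X.proj η

end Construction

section LeftInvariant

variable {s : ℕ}

/-- The affine action on `ℂˢ × ℂ` of the element `(r, u, v)` of the solvable Lie group
`G = ℝˢ ⋉_φ (ℝˢ × ℂ)`, where `φ(r) = diag(e^{r₁}, …, e^{r_s}, e^{-(r₁ + ⋯ + r_s)/2 + i ∑ c_k r_k})`. -/
def solvAffine (c : Fin s → ℝ) (r u : Fin s → ℝ) (v : ℂ) (p : Model s 1) : Model s 1 :=
  (fun i ↦ (Real.exp (r i) : ℂ) * p.1 i + (u i : ℂ),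
    fun j ↦ Complex.exp (-(∑ i, r i) / 2 + Complex.I * ∑ i, c i * r i) * p.2 j + v)

lemma solvAffine_mem (c r u : Fin s → ℝ) (v : ℂ) {p : Model s 1} (hp : p ∈ domain s 1) :
    solvAffine c r u v p ∈ domain s 1 := fun i ↦ by
  simpa only [solvAffine, Complex.add_im, Complex.im_ofReal_mul, Complex.ofReal_im, add_zero]
    using mul_pos (Real.exp_pos (r i)) (hp i)

/-- The group `G` acts simply transitively on `Hˢ × ℂ`. Under the identification
`G ≃ Hˢ × ℂ, g ↦ g • (i, …, i, 0)`, this is the left translation by `(r, u, v)`. -/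
def solvTranslation (c r u : Fin s → ℝ) (v : ℂ) (p : domain s 1) : domain s 1 :=
  ⟨solvAffine c r u v p, solvAffine_mem c r u v p.2⟩

/-- A differential form on `X(K, U)` is left-invariant if its lift to `Hˢ × ℂ ≃ G` is invariant
under all left translations of `G = ℝˢ ⋉_φ (ℝˢ × ℂ)`. -/
def IsLeftInvariant {K : Type*} [Field K] [NumberField K] (X : Datum K s 1) (c : Fin s → ℝ)
    {n : ℕ} (η : DForm (Model s 1) X.Manifold ℂ n) : Prop :=
  ∀ (r u : Fin s → ℝ) (v : ℂ),
    DForm.pullback (E := Model s 1) (E' := Model s 1) (solvTranslation c r u v) (X.lift η) =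
      X.lift η

end LeftInvariant

end OeljeklausToma

end

/-!
Let `Ω` be the lift to `Hˢ × ℂ` of a `ddᶜ`-closed `(1,1)`-form on `X(K, U)`, and let
`h = Ω(e, i e)`, for `e = (0; 1)`, be its component along the factor `ℂ`.

Put `d = (1, …, 1; 0)`. In the expansion of `ddᶜ Ω (d, i d, e, i e) = 0`, every term other than the
second derivative of `h` along `i d` is a derivative in one of the directions `d`, `e`, `i e`, all of
which lie in `ℝˢ × ℂ`. The ring of integers acts on `Hˢ × ℂ` by translations, and by Dedekind's
independence of characters its image spans `ℝˢ × ℂ` (`Datum.span_embed`). All coefficients of `Ω`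
have these periods, so the extra terms vanish after averaging over a cube spanned by finitely many
periods: the average of `h` at height `t • i d`, as a function of `t > 0`, is affine
(`ComplexManifold.exists_average_eq_affine`).

* For a Hermitian metric, `h / ∏ Im xᵢ` is positive, and it is invariant under `U ⋉ 𝓞 K` because the
  conjugates of a unit have product `1`. The action is cocompact, so `h ≥ c ∏ Im xᵢ` with `c > 0`
  (`Datum.exists_le_fundamentalForm`), and the average of `h` is at least `c tˢ`.
* For a left-invariant form, `h` is a constant times `∏ Im xᵢ` (`IsLeftInvariant.liftExt_diag`),
  so the average of `h` is a constant times `tˢ`.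

As `s ≥ 2`, no affine function dominates `c tˢ` with `c > 0`. The first case is thus impossible, and
in the second case the constant is `0`.

The forms on the quotient are compared with forms on the open subset `Hˢ × ℂ` of a vector space by
means of `Datum.exists_chartAt_proj`: in the charts, the projection is given by elements
of `U ⋉ 𝓞 K`, which are complex affine maps, and `ddᶜ` commutes with these
(`localDdc_comp_affine`).
-/

noncomputable section

/-! ### Averages of periodic functions over a cube -/

namespace ComplexManifold

open MeasureTheory Set

section Average

variable {V : Type*} [NormedAddCommGroup V] [NormedSpace ℝ V]
  {F : Type*} [NormedAddCommGroup F] [NormedSpace ℝ F] {n : ℕ}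

/-- The derivative of a function with periods `b j`, in a direction spanned by these periods, has
vanishing integral over the cube spanned by them. -/
lemma integral_fderiv_eq_zero_of_periodic [CompleteSpace F] {D : Set V} (hDo : IsOpen D)
    (b : Fin (n + 1) → V)
    {f : V → F} (hf : ContDiffOn ℝ 1 f D) (hper : ∀ z j, f (z + b j) = f z) {q : V}
    (hq : ∀ θ : Fin (n + 1) → ℝ, q + ∑ j, θ j • b j ∈ D)
    {w : V} (hw : w ∈ Submodule.span ℝ (range b)) :
    ∫ θ in Icc (0 : Fin (n + 1) → ℝ) 1, fderiv ℝ f (q + ∑ j, θ j • b j) w = 0 := by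
  obtain ⟨c, rfl⟩ := (Submodule.mem_span_range_iff_exists_fun ℝ).1 hw
  let P : (Fin (n + 1) → ℝ) →L[ℝ] V :=
    ∑ j, (ContinuousLinearMap.proj (R := ℝ) (φ := fun _ : Fin (n + 1) ↦ ℝ) j).smulRight (b j)
  have hP : ∀ θ, P θ = ∑ j, θ j • b j := fun θ ↦ by simp [P]
  have hfd : ∀ θ, HasFDerivAt f (fderiv ℝ f (q + P θ)) (q + P θ) := fun θ ↦
    ((hf.contDiffAt (hDo.mem_nhds (by rw [hP]; exact hq θ))).differentiableAt
      one_ne_zero).hasFDerivAt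
  have hfc : Continuous fun θ ↦ fderiv ℝ f (q + P θ) :=
    (hf.continuousOn_fderiv_of_isOpen hDo le_rfl).comp_continuous (by fun_prop)
      fun θ ↦ by rw [hP]; exact hq θ
  have hG : ∀ θ, HasFDerivAt (fun θ ↦ f (q + P θ)) ((fderiv ℝ f (q + P θ)).comp P) θ := fun θ ↦
    (hfd θ).comp θ (P.hasFDerivAt.const_add q)
  have key := integral_divergence_of_hasFDerivAt_off_countable' (0 : Fin (n + 1) → ℝ) 1
    zero_le_one (fun j θ ↦ c j • f (q + P θ))
    (fun j θ ↦ c j • (fderiv ℝ f (q + P θ)).comp P) ∅ countable_empty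
    (fun j θ _ ↦ ((hG θ).const_smul (c j)).continuousAt.continuousWithinAt)
    (fun θ _ j ↦ (hG θ).const_smul (c j))
    ((Continuous.continuousOn (by
      refine continuous_finsetSum _ fun j _ ↦ ?_
      simp only [smul_apply, ContinuousLinearMap.comp_apply]
      exact (hfc.clm_apply continuous_const).const_smul _)).integrableOn_compact isCompact_Icc)
  have hPs : ∀ j, P (Pi.single j 1) = b j := fun j ↦ by
    rw [hP, Finset.sum_eq_single j] <;> simp +contextual
  -- opposite faces differ by a period, so that their contributions cancel
  have hface : ∀ (j : Fin (n + 1)) (x : Fin n → ℝ),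
      f (q + P (j.insertNth (α := fun _ ↦ ℝ) 1 x)) =
        f (q + P (j.insertNth (α := fun _ ↦ ℝ) 0 x)) := by
    intro j x
    rw [← hper (q + P (j.insertNth (α := fun _ ↦ ℝ) 0 x)) j, add_assoc, ← hPs j, ← map_add]
    congr 3
    refine (Fin.eq_insertNth_iff.2 ⟨?_, ?_⟩).symm
    · simp
    · funext i
      simp [Fin.removeNth]
  simp only [Pi.zero_apply, Pi.one_apply, hface, sub_self, Finset.sum_const_zero, smul_apply,
    ContinuousLinearMap.comp_apply, hPs] at key
  simpa only [map_sum, map_smul, hP] using key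

/-- Differentiation under the integral over a cube, along a ray. -/
lemma hasDerivAt_integral_cube {D : Set V} (hDo : IsOpen D) (b : Fin n → V)
    {f : V → F} (hf : ContDiffOn ℝ 1 f D) {q : V}
    (hq : ∀ t : ℝ, 0 < t → ∀ θ : Fin n → ℝ, t • q + ∑ j, θ j • b j ∈ D) {t : ℝ} (ht : 0 < t) :
    HasDerivAt (fun t : ℝ ↦ ∫ θ in Icc (0 : Fin n → ℝ) 1, f (t • q + ∑ j, θ j • b j))
      (∫ θ in Icc (0 : Fin n → ℝ) 1, fderiv ℝ f (t • q + ∑ j, θ j • b j) q) t := by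
  have hcts : Continuous fun p : ℝ × (Fin n → ℝ) ↦ p.1 • q + ∑ j, p.2 j • b j := by fun_prop
  have hfc : ContinuousOn (fun p : ℝ × (Fin n → ℝ) ↦ f (p.1 • q + ∑ j, p.2 j • b j))
      (Ioi 0 ×ˢ univ) :=
    hf.continuousOn.comp hcts.continuousOn fun p hp ↦ hq _ hp.1 _
  have hfd : ContinuousOn (fun p : ℝ × (Fin n → ℝ) ↦ fderiv ℝ f (p.1 • q + ∑ j, p.2 j • b j) q)
      (Ioi 0 ×ˢ univ) :=
    ((hf.continuousOn_fderiv_of_isOpen hDo le_rfl).comp hcts.continuousOn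
      fun p hp ↦ hq _ hp.1 _).clm_apply continuousOn_const
  have hslice : ∀ {g : ℝ × (Fin n → ℝ) → F}, ContinuousOn g (Ioi 0 ×ˢ univ) → ∀ u : ℝ, 0 < u →
      Continuous fun θ ↦ g (u, θ) := fun hg u hu ↦
    hg.comp_continuous (by fun_prop) fun θ ↦ ⟨hu, mem_univ _⟩
  obtain ⟨C, hC⟩ := ((isCompact_Icc (a := t / 2) (b := 2 * t)).prod
    (isCompact_Icc (a := (0 : Fin n → ℝ)) (b := 1))).exists_bound_of_continuousOn
    (hfd.mono (prod_mono (fun u hu ↦ (half_pos ht).trans_le hu.1) (subset_univ _)))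
  refine (hasDerivAt_integral_of_dominated_loc_of_deriv_le (bound := fun _ ↦ C)
    (μ := volume.restrict (Icc (0 : Fin n → ℝ) 1))
    (F := fun (t : ℝ) (θ : Fin n → ℝ) ↦ f (t • q + ∑ j, θ j • b j))
    (F' := fun (t : ℝ) (θ : Fin n → ℝ) ↦ fderiv ℝ f (t • q + ∑ j, θ j • b j) q)
    (Icc_mem_nhds (half_lt_self ht) (by linarith : t < 2 * t)) ?_ ?_ ?_ ?_ ?_ ?_).2
  · filter_upwards [lt_mem_nhds ht] with u hu
    exact (hslice hfc u hu).aestronglyMeasurable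
  · exact (hslice hfc t ht).continuousOn.integrableOn_compact isCompact_Icc
  · exact (hslice hfd t ht).aestronglyMeasurable
  · filter_upwards [ae_restrict_mem measurableSet_Icc] with θ hθ u hu
    exact hC (u, θ) ⟨hu, hθ⟩
  · exact continuousOn_const.integrableOn_compact isCompact_Icc
  · filter_upwards with θ u hu
    have hu0 : 0 < u := (half_pos ht).trans_le hu.1
    have h1 := ((hf.contDiffAt (hDo.mem_nhds (hq u hu0 θ))).differentiableAt
      one_ne_zero).hasFDerivAt
    have h2 : HasDerivAt (fun t : ℝ ↦ t • q + ∑ j, θ j • b j) q u := by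
      simpa using ((hasDerivAt_id u).smul_const q).add_const (∑ j, θ j • b j)
    exact h1.comp_hasDerivAt u h2

/-- A function on a half-line with constant derivative is affine. -/
lemma eq_add_smul_of_hasDerivAt_const {H : ℝ → F} {B : F}
    (h : ∀ t : ℝ, 0 < t → HasDerivAt H B t) {t : ℝ} (ht : 0 < t) :
    H t = (H 1 - B) + t • B := by
  have hd : ∀ t ∈ Ioi (0 : ℝ), HasDerivAt (fun t ↦ H t - t • B) 0 t := fun t ht ↦ by
    simpa using (h t ht).fun_sub ((hasDerivAt_id t).smul_const B)
  have := isOpen_Ioi.is_const_of_deriv_eq_zero (isPreconnected_Ioi (a := (0 : ℝ)))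
    (fun t ht ↦ (hd t ht).differentiableAt.differentiableWithinAt)
    (fun t ht ↦ (hd t ht).deriv) ht (mem_Ioi.2 one_pos)
  simp only [one_smul] at this
  rw [← this]
  abel

lemma integrableOn_cube_fderiv {D : Set V} (hDo : IsOpen D) (b : Fin n → V)
    {f : V → F} (hf : ContDiffOn ℝ 1 f D) {q : V}
    (hq : ∀ θ : Fin n → ℝ, q + ∑ j, θ j • b j ∈ D) (w : V) :
    IntegrableOn (fun θ ↦ fderiv ℝ f (q + ∑ j, θ j • b j) w) (Icc (0 : Fin n → ℝ) 1) :=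
  (Continuous.continuousOn <| ((hf.continuousOn_fderiv_of_isOpen hDo le_rfl).comp_continuous
    (by fun_prop) hq).clm_apply continuous_const).integrableOn_compact isCompact_Icc

lemma alternating_neg_swap (α : V [⋀^Fin 2]→L[ℝ] F) (v w : V) : α ![-w, v] = α ![v, w] := by
  have h1 := α.map_swap ![v, w] (i := 0) (j := 1) (by decide)
  have h2 := α.map_smul_univ ![-1, 1] ![w, v]
  have e1 : ![v, w] ∘ Equiv.swap (0 : Fin 2) 1 = ![w, v] := by
    ext i; fin_cases i <;> rfl
  have e2 : (fun i ↦ (![-1, 1] : Fin 2 → ℝ) i • (![w, v] : Fin 2 → V) i) = ![-w, v] := by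
    ext i; fin_cases i <;> simp
  rw [e1] at h1
  have h1' : α ![w, v] = -α ![v, w] := h1
  rw [e2, h1'] at h2
  simpa using h2

end Average

/-! ### `ddᶜ`-closed forms with periods -/

section DDc

variable {V : Type*} [NormedAddCommGroup V] [NormedSpace ℝ V] [NormedSpace ℂ V]
  [IsScalarTower ℝ ℂ V]
  {F : Type*} [NormedAddCommGroup F] [NormedSpace ℝ F] {n : ℕ}

lemma mulI_apply (v : V) : mulI V v = Complex.I • v := rfl

/-- `(dᶜ Ω)(v₀, …, v_k) = ∑ (-1)ⁱ ∂_{-J vᵢ} Ω(…)` for a `J`-invariant form, the arguments of `Ω`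
being rotated by `-J` as well. -/
lemma localDc_eq_of_invariant {D : Set V} (hDo : IsOpen D) {Ω : V → V [⋀^Fin n]→L[ℝ] F}
    (h11 : ∀ z ∈ D, (Ω z).compContinuousLinearMap (mulI V) = Ω z) {z : V} (hz : z ∈ D) :
    localDc Ω z = (extDeriv Ω z).compContinuousLinearMap (-mulI V) := by
  have : (fun z ↦ (Ω z).compContinuousLinearMap (mulI V)) =ᶠ[𝓝 z] Ω :=
    Filter.eventuallyEq_of_mem (hDo.mem_nhds hz) h11
  rw [localDc, this.extDeriv_eq]

lemma contDiffOn_localDc {D : Set V} (hDo : IsOpen D) {Ω : V → V [⋀^Fin n]→L[ℝ] F}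
    (h11 : ∀ z ∈ D, (Ω z).compContinuousLinearMap (mulI V) = Ω z)
    (hΩ : ContDiffOn ℝ 2 Ω D) : ContDiffOn ℝ 1 (localDc Ω) D := by
  refine ContDiffOn.congr ?_ fun z hz ↦ localDc_eq_of_invariant hDo h11 hz
  have h1 : ContDiffOn ℝ 1 (fderiv ℝ Ω) D := hΩ.fderiv_of_isOpen hDo le_rfl
  exact (ContinuousAlternatingMap.compContinuousLinearMapCLM (-mulI V)).contDiff.comp_contDiffOn
    ((ContinuousAlternatingMap.alternatizeUncurryFinCLM ℝ V F).contDiff.comp_contDiffOn h1)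

lemma localDc_add_period {Ω : V → V [⋀^Fin n]→L[ℝ] F} {c : V} (h : ∀ z, Ω (z + c) = Ω z) (z : V) :
    localDc Ω (z + c) = localDc Ω z := by
  have h1 := fderiv_comp_add_right (𝕜 := ℝ)
    (f := fun z ↦ (Ω z).compContinuousLinearMap (mulI V)) (x := z) c
  simp only [h] at h1
  simp only [localDc, extDeriv, h1]

/-- Let `Ω` be a `ddᶜ`-closed `(1,1)`-form with periods `b j`, whose real span contains `d` and the
complex line of `e`. The averages of the component `Ω(e, i e)` over the translates of the cube
spanned by the `b j` along the ray through `i d` form an affine function: up to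
derivatives along periods, `ddᶜ Ω (d, i d, e, i e)` is the second derivative of `Ω(e, i e)`
along `i d`. -/
theorem exists_average_eq_affine [CompleteSpace F] {D : Set V} (hDo : IsOpen D)
    (b : Fin (n + 1) → V) {Ω : V → V [⋀^Fin 2]→L[ℝ] F} (hΩ : ContDiffOn ℝ 2 Ω D)
    (h11 : ∀ z ∈ D, (Ω z).compContinuousLinearMap (mulI V) = Ω z)
    (hddc : ∀ z ∈ D, localDdc Ω z = 0) (hper : ∀ z j, Ω (z + b j) = Ω z) {d e : V}
    (hd : d ∈ Submodule.span ℝ (range b)) (he : e ∈ Submodule.span ℝ (range b))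
    (hie : Complex.I • e ∈ Submodule.span ℝ (range b))
    (hq : ∀ t : ℝ, 0 < t → ∀ θ : Fin (n + 1) → ℝ, t • Complex.I • d + ∑ j, θ j • b j ∈ D) :
    ∃ A B : F, ∀ t : ℝ, 0 < t →
      ∫ θ in Icc (0 : Fin (n + 1) → ℝ) 1,
        Ω (t • Complex.I • d + ∑ j, θ j • b j) ![e, Complex.I • e] = A + t • B := by
  let v : Fin 4 → V := ![d, Complex.I • d, e, Complex.I • e]
  let f : Fin 4 → V → F := fun k z ↦ localDc Ω z (k.removeNth v)
  have hdc := contDiffOn_localDc hDo h11 hΩ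
  have hf : ∀ k, ContDiffOn ℝ 1 (f k) D := fun k ↦
    (ContinuousAlternatingMap.apply ℝ V F (k.removeNth v)).contDiff.comp_contDiffOn hdc
  have hfper : ∀ k z j, f k (z + b j) = f k z := fun k z j ↦ by
    simp only [f, localDc_add_period fun z ↦ hper z j]
  have hΩw : ∀ w : Fin 2 → V, ContDiffOn ℝ 1 (fun z ↦ Ω z w) D := fun w ↦
    ((ContinuousAlternatingMap.apply ℝ V F w).contDiff.comp_contDiffOn hΩ).of_le
      (by norm_num)
  have hΩper : ∀ (w : Fin 2 → V) z j, Ω (z + b j) w = Ω z w := fun w z j ↦ by rw [hper]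
  -- the equation `ddᶜ Ω (d, i d, e, i e) = 0`
  have hclosed : ∀ z ∈ D, fderiv ℝ (f 1) z (Complex.I • d) = fderiv ℝ (f 0) z d +
      fderiv ℝ (f 2) z e - fderiv ℝ (f 3) z (Complex.I • e) := fun z hz ↦ by
    have h1 := congrArg (fun α ↦ α v) (hddc z hz)
    simp only [localDdc] at h1
    rw [extDeriv_apply ((hdc.contDiffAt (hDo.mem_nhds hz)).differentiableAt one_ne_zero)] at h1
    rw [Fin.sum_univ_four] at h1
    have h2 : (-1) ^ 0 • fderiv ℝ (f 0) z d + (-1) ^ 1 • fderiv ℝ (f 1) z (Complex.I • d) +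
      (-1) ^ 2 • fderiv ℝ (f 2) z e + (-1) ^ 3 • fderiv ℝ (f 3) z (Complex.I • e) = 0 := h1
    rw [← sub_eq_zero, ← neg_eq_zero, ← h2]
    simp only [pow_zero, pow_succ, mul_neg, mul_one, neg_neg, neg_smul, one_smul]
    abel
  -- `dᶜ Ω (d, e, i e)` is minus the derivative of `Ω(e, i e)` along `i d`, up to derivatives along
  -- the periods
  have hf1 : ∀ z ∈ D, f 1 z = -fderiv ℝ (fun z ↦ Ω z ![e, Complex.I • e]) z (Complex.I • d) +
      fderiv ℝ (fun z ↦ Ω z ![-(Complex.I • d), e]) z (Complex.I • e) +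
      fderiv ℝ (fun z ↦ Ω z ![-(Complex.I • d), -(Complex.I • e)]) z e := fun z hz ↦ by
    simp only [f]
    rw [localDc_eq_of_invariant hDo h11 hz,
      ContinuousAlternatingMap.compContinuousLinearMap_apply, extDeriv_apply
      ((hΩ.contDiffAt (hDo.mem_nhds hz)).differentiableAt two_ne_zero)]
    have e1 : (-mulI V) ∘ Fin.removeNth 1 v = ![-(Complex.I • d), -(Complex.I • e), e] := by
      ext k
      fin_cases k
      · rfl
      · rfl
      · change -(Complex.I • Complex.I • e) = e
        rw [smul_smul, Complex.I_mul_I, neg_one_smul, neg_neg]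
    have e2 : ∀ x y w : V, (0 : Fin 3).removeNth ![x, y, w] = ![y, w] := fun x y w ↦ by
      ext k; fin_cases k <;> rfl
    have e3 : ∀ x y w : V, (1 : Fin 3).removeNth ![x, y, w] = ![x, w] := fun x y w ↦ by
      ext k; fin_cases k <;> rfl
    have e4 : ∀ x y w : V, (2 : Fin 3).removeNth ![x, y, w] = ![x, y] := fun x y w ↦ by
      ext k; fin_cases k <;> rfl
    rw [e1, Fin.sum_univ_three, e2, e3, e4]
    simp [alternating_neg_swap]
  -- so the average of `dᶜ Ω (d, e, i e)` has derivative zero along the ray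
  have hF1 : ∀ t : ℝ, 0 < t → HasDerivAt (fun t : ℝ ↦ ∫ θ in Icc (0 : Fin (n + 1) → ℝ) 1,
      f 1 (t • Complex.I • d + ∑ j, θ j • b j)) 0 t := fun t ht ↦ by
    have h1 := hasDerivAt_integral_cube hDo b (hf 1) hq ht
    simp only [hclosed _ (hq t ht _)] at h1
    have hint := fun k w ↦ integrableOn_cube_fderiv hDo b (hf k) (hq t ht) w
    have hzero := fun k w hw ↦
      integral_fderiv_eq_zero_of_periodic hDo b (hf k) (hfper k) (hq t ht) (w := w) hw
    rw [integral_sub ((hint _ _).fun_add (hint _ _)) (hint _ _),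
      integral_add (hint _ _) (hint _ _), hzero 0 d hd, hzero 2 e he, hzero 3 _ hie,
      add_zero, sub_zero] at h1
    exact h1
  obtain ⟨B, hB⟩ : ∃ B : F, ∀ t : ℝ, 0 < t → ∫ θ in Icc (0 : Fin (n + 1) → ℝ) 1,
      f 1 (t • Complex.I • d + ∑ j, θ j • b j) = -B :=
    ⟨_, fun t ht ↦ (eq_add_smul_of_hasDerivAt_const hF1 ht).trans
      (by rw [smul_zero, sub_zero, add_zero, neg_neg])⟩
  refine ⟨_, B, fun t ht ↦ eq_add_smul_of_hasDerivAt_const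
    (H := fun t ↦ ∫ θ in Icc (0 : Fin (n + 1) → ℝ) 1,
      Ω (t • Complex.I • d + ∑ j, θ j • b j) ![e, Complex.I • e]) (fun t ht ↦ ?_) ht⟩
  have h1 := hasDerivAt_integral_cube hDo b (hΩw ![e, Complex.I • e]) hq ht
  convert h1 using 1
  have h2 := hB t ht
  have hint := fun w u ↦ integrableOn_cube_fderiv hDo b (hΩw w) (hq t ht) u
  have hzero := fun w u hu ↦
    integral_fderiv_eq_zero_of_periodic hDo b (hΩw w) (hΩper w) (hq t ht) (w := u) hu
  simp only [hf1 _ (hq t ht _)] at h2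
  rw [integral_add ((hint _ _).fun_neg.fun_add (hint _ _)) (hint _ _),
    integral_add (hint _ _).fun_neg (hint _ _), hzero _ _ hie, hzero _ _ he, add_zero, add_zero,
    integral_neg] at h2
  exact (neg_injective h2).symm

end DDc

end ComplexManifold

end

noncomputable section

/-! ### The lattices attached to the number field -/

section Lattice

variable {E : Type*} [NormedAddCommGroup E] [NormedSpace ℝ E]

lemma AddSubgroup.exists_fin_span_eq_top [FiniteDimensional ℝ E] (L : AddSubgroup E)
    (h : Submodule.span ℝ (L : Set E) = ⊤) :
    ∃ (n : ℕ) (b : Fin (n + 1) → E), (∀ j, b j ∈ L) ∧ Submodule.span ℝ (Set.range b) = ⊤ := by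
  obtain ⟨B, hBL, hB, hli⟩ := exists_linearIndependent ℝ (L : Set E)
  have : Finite B := hli.finite
  obtain ⟨n, ⟨φ⟩⟩ := Finite.exists_equiv_fin B
  refine ⟨n, Fin.cons 0 fun j ↦ φ.symm j, fun j ↦ ?_, ?_⟩
  · refine Fin.cases L.zero_mem (fun j ↦ hBL (φ.symm j).2) j
  · rw [Fin.range_cons, Submodule.span_insert_zero, ← h, ← hB]
    congr 1
    ext x
    exact ⟨by rintro ⟨j, rfl⟩; exact (φ.symm j).2, fun hx ↦ ⟨φ ⟨x, hx⟩, by simp⟩⟩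

/-- A subgroup that spans a real vector space of finite dimension is cobounded. -/
lemma AddSubgroup.exists_norm_add_le [FiniteDimensional ℝ E] (L : AddSubgroup E)
    (h : Submodule.span ℝ (L : Set E) = ⊤) : ∃ R : ℝ, ∀ x : E, ∃ l ∈ L, ‖x + l‖ ≤ R := by
  obtain ⟨n, b, hb, hspan⟩ := L.exists_fin_span_eq_top h
  refine ⟨∑ j, ‖b j‖, fun x ↦ ?_⟩
  obtain ⟨c, rfl⟩ := (Submodule.mem_span_range_iff_exists_fun ℝ).1
    (hspan ▸ Submodule.mem_top : x ∈ Submodule.span ℝ (Set.range b))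
  refine ⟨-∑ j, ⌊c j⌋ • b j, neg_mem (sum_mem fun j _ ↦ zsmul_mem (hb j) _), ?_⟩
  rw [← sub_eq_add_neg, ← Finset.sum_sub_distrib]
  refine norm_sum_le_of_le _ fun j _ ↦ ?_
  rw [← Int.cast_smul_eq_zsmul ℝ, ← sub_smul, norm_smul, Int.self_sub_floor, Real.norm_eq_abs,
    Int.abs_fract]
  exact mul_le_of_le_one_left (norm_nonneg _) (Int.fract_lt_one _).le

end Lattice

namespace OeljeklausToma

open ComplexManifold

section Embedding

variable {K : Type*} [Field K] [NumberField K] {s t : ℕ}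

/-- The embedding `b ↦ (σ₁(b), …, σ_s(b), σ_{s+1}(b), …, σ_{s+t}(b))` of the ring of integers in
`ℝˢ × ℂᵗ`. -/
def Datum.embed (X : Datum K s t) : 𝓞 K →+ (Fin s → ℝ) × (Fin t → ℂ) where
  toFun b := (fun i ↦ X.σ i b, fun j ↦ X.τ j b)
  map_zero' := by ext <;> simp
  map_add' a b := by ext <;> simp

/-- By Dedekind's independence of characters, no nonzero real linear form on `ℝˢ × ℂᵗ` vanishes on
the image of the ring of integers. -/
lemma Datum.span_embed (X : Datum K s t) :
    Submodule.span ℝ (X.embed.range : Set ((Fin s → ℝ) × (Fin t → ℂ))) = ⊤ := by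
  by_contra hne
  obtain ⟨f, hf0, hf⟩ := Submodule.exists_le_ker_of_lt_top _ (lt_top_iff_ne_top.2 hne)
  refine hf0 ?_
  let r : Fin s → ℝ := fun i ↦ f (Pi.single i 1, 0)
  let α : Fin t → ℝ := fun j ↦ f (0, Pi.single j 1)
  let β : Fin t → ℝ := fun j ↦ f (0, Pi.single j Complex.I)
  have hexp : ∀ x z, f (x, z) = ∑ i, x i * r i + ∑ j, ((z j).re * α j + (z j).im * β j) := by
    intro x z
    have hx : x = ∑ i, x i • Pi.single i (1 : ℝ) := by
      simpa using (pi_eq_sum_univ' x)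
    have hz : z = ∑ j, ((z j).re •
        (Pi.single j 1 : Fin t → ℂ) + (z j).im • (Pi.single j Complex.I : Fin t → ℂ)) := by
      funext k
      simp [Finset.sum_apply, Pi.single_apply, Finset.sum_add_distrib]
    have h1 : f (x, 0) = ∑ i, x i * r i := by
      have : (x, (0 : Fin t → ℂ)) = LinearMap.inl ℝ _ _ x := rfl
      rw [this]
      conv_lhs => rw [hx]
      simp [r, -LinearMap.coe_inl]
      rfl
    have h2 : f (0, z) = ∑ j, ((z j).re * α j + (z j).im * β j) := by
      have : ((0 : Fin s → ℝ), z) = LinearMap.inr ℝ _ _ z := rfl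
      rw [this]
      conv_lhs => rw [hz]
      simp [α, β, -LinearMap.coe_inr]
      rfl
    rw [← h1, ← h2, ← map_add]
    simp
  -- the form as a complex combination of the embeddings: `α Re + β Im` is
  -- `(α - i β) / 2` times the identity plus `(α + i β) / 2` times the conjugation
  let ψ : Fin s ⊕ (Fin t ⊕ Fin t) → (𝓞 K →* ℂ) := fun k ↦
    (((Sum.elim (fun i ↦ Complex.ofRealHom.comp (X.σ i))
      (Sum.elim X.τ (fun j ↦ (starRingEnd ℂ).comp (X.τ j)))) k).comp
        (algebraMap (𝓞 K) K) : 𝓞 K →+* ℂ)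
  have hψ : Function.Injective ψ := fun k l hkl ↦ by
    refine X.bijective.1 (IsLocalization.ringHom_ext (nonZeroDivisors (𝓞 K)) (RingHom.ext fun b ↦ ?_))
    exact DFunLike.congr_fun hkl b
  have hli := (linearIndependent_monoidHom (𝓞 K) ℂ).comp ψ hψ
  let w : Fin s ⊕ (Fin t ⊕ Fin t) → ℂ := Sum.elim (fun i ↦ (r i : ℂ))
    (Sum.elim (fun j ↦ (α j - β j * Complex.I) / 2) (fun j ↦ (α j + β j * Complex.I) / 2))
  have hw := Fintype.linearIndependent_iff.1 hli w (by
    funext b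
    have h0 : f (X.embed b) = 0 := hf (Submodule.subset_span ⟨b, rfl⟩)
    have h1 := congrArg (fun x : ℝ ↦ (x : ℂ)) ((hexp _ _).symm.trans h0)
    simp only [Complex.ofReal_add, Complex.ofReal_sum, Complex.ofReal_mul,
      Complex.ofReal_zero] at h1
    rw [Finset.sum_apply, Pi.zero_apply, ← h1, Fintype.sum_sum_type, Fintype.sum_sum_type,
      ← Finset.sum_add_distrib]
    congr 1
    · refine Finset.sum_congr rfl fun i _ ↦ ?_
      simp [w, ψ, mul_comm]
    · refine Finset.sum_congr rfl fun j _ ↦ ?_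
      have hre := Complex.re_eq_add_conj (X.τ j b)
      have him := Complex.im_eq_sub_conj (X.τ j b)
      simp [w, ψ, hre, him]
      field_simp
      ring_nf
      simp
      ring)
  have hr : ∀ i, r i = 0 := fun i ↦ by simpa [w] using hw (Sum.inl i)
  have hα : ∀ j, α j = 0 ∧ β j = 0 := fun j ↦ by
    have h1 := congrArg Complex.re (hw (Sum.inr (Sum.inl j)))
    have h2 := congrArg Complex.im (hw (Sum.inr (Sum.inl j)))
    simpa [w] using And.intro h1 h2
  refine LinearMap.ext fun p ↦ ?_
  rw [← Prod.mk.eta (p := p), hexp]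
  simp [hr, hα]

/-- The product of all the conjugates of a unit `a ∈ U` is `1`. -/
lemma Datum.prod_unit (X : Datum K s t) {a : (𝓞 K)ˣ} (ha : a ∈ X.U) :
    (∏ i, X.σ i ((a : 𝓞 K) : K)) * ∏ j, ‖X.τ j ((a : 𝓞 K) : K)‖ ^ 2 = 1 := by
  have h1 : |Algebra.norm ℚ ((a : 𝓞 K) : K)| = 1 := by
    simp
  have h2 := Algebra.norm_eq_prod_embeddings ℚ ℂ ((a : 𝓞 K) : K)
  rw [← Equiv.prod_comp (RingHom.equivRatAlgHom K ℂ)] at h2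
  have h3 := congrArg norm h2
  rw [norm_prod, ← Equiv.prod_comp (Equiv.ofBijective _ X.bijective), Fintype.prod_sum_type,
    Fintype.prod_sum_type, ← Finset.prod_mul_distrib] at h3
  have h4 : ‖algebraMap ℚ ℂ (Algebra.norm ℚ ((a : 𝓞 K) : K))‖ = 1 := by
    rw [eq_ratCast, Complex.norm_ratCast]
    exact_mod_cast h1
  rw [h4] at h3
  rw [h3]
  congr 1
  · refine Finset.prod_congr rfl fun i _ ↦ ?_
    simp [abs_of_pos (X.U_pos a ha i)]
  · refine Finset.prod_congr rfl fun j _ ↦ ?_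
    simp [sq]

/-- The action of `U ⋉ 𝓞 K` on `Hˢ × ℂᵗ` is cocompact: in the coordinates
`(log Im x, Re x, z)`, the group `U` translates the first component by a lattice of `ℝˢ`, and
`𝓞 K` translates the other ones by a lattice of `ℝˢ × ℂᵗ`. -/
lemma Datum.exists_isCompact_smul_mem (X : Datum K s t) :
    ∃ C : Set (domain s t), IsCompact C ∧ ∀ p, ∃ g : X.Γ, g • p ∈ C := by
  obtain ⟨R, hR⟩ := AddSubgroup.exists_norm_add_le _ X.span
  obtain ⟨R', hR'⟩ := AddSubgroup.exists_norm_add_le _ X.span_embed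
  let Φ : (Fin s → ℝ) × ((Fin s → ℝ) × (Fin t → ℂ)) → domain s t := fun q ↦
    ⟨(fun i ↦ (q.2.1 i : ℂ) + (Real.exp (q.1 i) : ℂ) * Complex.I, q.2.2), fun i ↦ by
      simp only [Complex.add_im, Complex.ofReal_im, Complex.im_ofReal_mul, Complex.I_im]
      positivity⟩
  have hΦ : Continuous Φ := by
    refine Continuous.subtype_mk ?_ _
    fun_prop
  refine ⟨Φ '' (Metric.closedBall 0 R ×ˢ Metric.closedBall 0 R'),
    ((isCompact_closedBall _ _).prod (isCompact_closedBall _ _)).image hΦ, fun p ↦ ?_⟩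
  obtain ⟨_, ⟨a, ha, rfl⟩, hl⟩ := hR fun i ↦ Real.log ((p : Model s t).1 i).im
  let u : (𝓞 K)ˣ := a.toMul
  have hu : u ∈ X.U := ha
  obtain ⟨_, ⟨b, rfl⟩, hb⟩ := hR' (fun i ↦ X.σ i ((u : 𝓞 K) : K) * ((p : Model s t).1 i).re,
    fun j ↦ X.τ j ((u : 𝓞 K) : K) * (p : Model s t).2 j)
  obtain ⟨g, hgu, hgi⟩ : ∃ g : X.Γ, g.unit = u ∧ g.int = b :=
    ⟨(⟨Multiplicative.ofAdd b, ⟨u, hu⟩⟩ : Multiplicative (𝓞 K) ⋊[unitsAct X.U] X.U), rfl, rfl⟩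
  have him : ∀ i, Real.exp (Real.log ((p : Model s t).1 i).im + logProj X.σ a i) =
      X.σ i ((u : 𝓞 K) : K) * ((p : Model s t).1 i).im := fun i ↦ by
    have h1 : logProj X.σ a i = Real.log (X.σ i ((u : 𝓞 K) : K)) := by
      rw [← abs_of_pos (X.U_pos _ hu i)]
      rfl
    rw [h1, Real.exp_add, Real.exp_log (p.2 i), Real.exp_log (X.U_pos _ hu i), mul_comm]
  refine ⟨g, (_, _), ⟨mem_closedBall_zero_iff.2 hl, mem_closedBall_zero_iff.2 hb⟩,
    Subtype.ext (Prod.ext (funext fun i ↦ ?_) ?_)⟩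
  · simp only [Datum.coe_smul, Datum.affine, hgu, hgi, Φ, Pi.add_apply, him]
    refine Complex.ext ?_ ?_ <;> simp [Datum.embed]
  · simp only [Datum.coe_smul, Datum.affine, hgu, hgi, Φ]
    rfl

end Embedding

end OeljeklausToma

end

noncomputable section

/-! ### Naturality of `ddᶜ` -/

namespace ComplexManifold

section Naturality

variable {V : Type*} [NormedAddCommGroup V] [NormedSpace ℝ V] [NormedSpace ℂ V]
  [IsScalarTower ℝ ℂ V]
  {F : Type*} [NormedAddCommGroup F] [NormedSpace ℝ F] {n : ℕ}

omit [NormedSpace ℂ V] [IsScalarTower ℝ ℂ V] in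
lemma extDeriv_comp_affine {α : V → V [⋀^Fin n]→L[ℝ] F} {A : V → V} {A' : V →L[ℝ] V}
    (hA : ∀ z, HasFDerivAt A A' z) {x : V} (hα : DifferentiableAt ℝ α (A x)) :
    extDeriv (fun z ↦ (α (A z)).compContinuousLinearMap A') x =
      (extDeriv α (A x)).compContinuousLinearMap A' := by
  have hfd : fderiv ℝ A = fun _ ↦ A' := funext fun z ↦ (hA z).fderiv
  have hc : ContDiff ℝ 2 A :=
    (contDiff_succ_iff_fderiv (n := 1)).2 ⟨fun z ↦ (hA z).differentiableAt, by simp, by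
      rw [hfd]
      exact contDiff_const⟩
  have := extDeriv_pullback (f := A) hα hc.contDiffAt (by simp)
  simpa only [hfd] using this

/-- `d dᶜ` commutes with the pullback by a complex affine map. -/
lemma localDdc_comp_affine {D : Set V} (hDo : IsOpen D) {Ω : V → V [⋀^Fin n]→L[ℝ] F}
    (h11 : ∀ z ∈ D, (Ω z).compContinuousLinearMap (mulI V) = Ω z) (hΩ : ContDiffOn ℝ 2 Ω D)
    {A : V → V} {A' : V →L[ℂ] V} (hA : ∀ z, HasFDerivAt A (A'.restrictScalars ℝ) z)
    (hAD : ∀ z ∈ D, A z ∈ D)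
    (hinv : ∀ z ∈ D, Ω z = (Ω (A z)).compContinuousLinearMap (A'.restrictScalars ℝ))
    {z : V} (hz : z ∈ D) :
    localDdc Ω z = (localDdc Ω (A z)).compContinuousLinearMap (A'.restrictScalars ℝ) := by
  have hdc : ∀ z ∈ D, localDc Ω z =
      (localDc Ω (A z)).compContinuousLinearMap (A'.restrictScalars ℝ) := fun z hz ↦ by
    have h1 : Ω =ᶠ[𝓝 z] fun z ↦ (Ω (A z)).compContinuousLinearMap (A'.restrictScalars ℝ) :=
      Filter.eventuallyEq_of_mem (hDo.mem_nhds hz) hinv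
    rw [localDc_eq_of_invariant hDo h11 hz, localDc_eq_of_invariant hDo h11 (hAD z hz),
      h1.extDeriv_eq, extDeriv_comp_affine hA
        ((hΩ.contDiffAt (hDo.mem_nhds (hAD z hz))).differentiableAt two_ne_zero)]
    ext v
    simp only [ContinuousAlternatingMap.compContinuousLinearMap_apply]
    congr 1
    funext i
    simp [mulI_apply]
  have h2 : localDc Ω =ᶠ[𝓝 z]
      fun z ↦ (localDc Ω (A z)).compContinuousLinearMap (A'.restrictScalars ℝ) :=
    Filter.eventuallyEq_of_mem (hDo.mem_nhds hz) hdc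
  rw [localDdc, h2.extDeriv_eq, extDeriv_comp_affine hA
    (((contDiffOn_localDc hDo h11 hΩ).contDiffAt
      (hDo.mem_nhds (hAD z hz))).differentiableAt one_ne_zero)]

lemma localDdc_congr {Ω Ω' : V → V [⋀^Fin n]→L[ℝ] F} {z : V} (h : Ω =ᶠ[𝓝 z] Ω') :
    localDdc Ω z = localDdc Ω' z := by
  refine Filter.EventuallyEq.extDeriv_eq ?_
  filter_upwards [h.eventuallyEq_nhds] with y hy
  rw [localDc, localDc]
  congr 1
  refine Filter.EventuallyEq.extDeriv_eq ?_
  filter_upwards [hy] with x hx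
  rw [hx]

end Naturality

end ComplexManifold

namespace OeljeklausToma

open ComplexManifold

/-! ### The projection to the quotient -/

section Projection

set_option linter.unusedSectionVars false

variable {K : Type*} [Field K] [NumberField K] {s t : ℕ}

lemma chartAt_domain_symm (p : domain s t) {z : Model s t}
    (hz : z ∈ (chartAt (Model s t) p).target) :
    ((chartAt (Model s t) p).symm z : Model s t) = z := (chartAt (Model s t) p).right_inv hz

lemma eventually_chartAt_domain_symm (p : domain s t) : ∀ᶠ z in 𝓝 (p : Model s t),
    ((chartAt (Model s t) p).symm z : Model s t) = z :=
  Filter.eventually_of_mem (chart_target_mem_nhds (Model s t) p) fun _ hz ↦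
    chartAt_domain_symm p hz

lemma continuousAt_chartAt_domain_symm (p : domain s t) :
    Filter.Tendsto (chartAt (Model s t) p).symm (𝓝 (p : Model s t)) (𝓝 p) := by
  have := (chartAt (Model s t) p).symm.continuousAt
    (mem_chart_target (Model s t) p)
  rw [ContinuousAt, (chartAt (Model s t) p).left_inv (mem_chart_source _ p)] at this
  exact this

/-- In the charts of `Hˢ × ℂᵗ` and `X(K, U)`, the projection is given near each point by
an element of `U ⋉ 𝓞 K`. -/
lemma Datum.exists_chartAt_proj (X : Datum K s t) (p : domain s t) : ∃ g : X.Γ,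
    chartAt (Model s t) (X.proj p) (X.proj p) = X.affine g p ∧
    (∀ᶠ p' in 𝓝 p, chartAt (Model s t) (X.proj p) (X.proj p') = X.affine g p') ∧
    ∀ᶠ z in 𝓝 (X.affine g p), ∃ h : z ∈ domain s t,
      (chartAt (Model s t) (X.proj p)).symm z = X.proj ⟨z, h⟩ := by
  have hcov : IsQuotientCoveringMap X.proj X.Γ :=
    isQuotientCoveringMap_quotientMk_of_properlyDiscontinuousSMul
  have hloc : IsLocalHomeomorph X.proj := hcov.isCoveringMap.isLocalHomeomorph
  let r : X.Manifold → domain s t := Quotient.mk_surjective.hasRightInverse.choose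
  have hr : ∀ x, X.proj (r x) = x := Quotient.mk_surjective.hasRightInverse.choose_spec
  let L := hloc.localInverseAt (r (X.proj p))
  let c := chartAt (Model s t) (r (X.proj p))
  have hφ : chartAt (Model s t) (X.proj p) = L.trans c := rfl
  have hsrc : X.proj p ∈ (L.trans c).source := mem_chart_source (Model s t) (X.proj p)
  have hLs : ∀ q, L.symm q = X.proj q := fun q ↦
    congrFun (hloc.localInverseAt_symm (x := r (X.proj p))) q
  have hfib : X.proj (L (X.proj p)) = X.proj p := by
    rw [← hLs, L.left_inv hsrc.1]
  obtain ⟨g, hg⟩ := hcov.apply_eq_iff_mem_orbit.mp hfib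
  have hg' : g • p = L (X.proj p) := hg
  have hev : ∀ᶠ p' in 𝓝 p, chartAt (Model s t) (X.proj p) (X.proj p') = X.affine g p' := by
    have hmem : g • p ∈ L.target := by
      rw [hg']
      exact L.map_source hsrc.1
    filter_upwards [(continuous_const_smul g).continuousAt.eventually
      (L.open_target.mem_nhds hmem)] with p' hp'
    have h3 : X.proj p' = L.symm (g • p') := by
      rw [hLs]
      exact (hcov.apply_eq_iff_mem_orbit.mpr ⟨g, rfl⟩).symm
    change c (L (X.proj p')) = _
    rw [h3, L.right_inv hp']
    rfl
  refine ⟨g, hev.self_of_nhds, hev, ?_⟩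
  have htgt : X.affine g p ∈ c.target := by
    rw [← hev.self_of_nhds]
    exact c.map_source hsrc.2
  filter_upwards [c.open_target.mem_nhds htgt] with z hz
  have hz' : (c.symm z : Model s t) = z := c.right_inv hz
  refine ⟨hz' ▸ (c.symm z).2, ?_⟩
  change L.symm (c.symm z) = _
  rw [hLs]
  congr 1
  exact Subtype.ext hz'

/-- The linear part of the affine transformation given by an element of `U ⋉ 𝓞 K`. -/
def Datum.linearPart (X : Datum K s t) (g : X.Γ) : Model s t →L[ℂ] Model s t :=
  (ContinuousLinearMap.pi fun i ↦ (X.σ i ((g.unit : 𝓞 K) : K) : ℂ) •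
      (ContinuousLinearMap.proj (R := ℂ) (φ := fun _ : Fin s ↦ ℂ) i).comp
        (ContinuousLinearMap.fst ℂ _ _)).prod
    (ContinuousLinearMap.pi fun j ↦ X.τ j ((g.unit : 𝓞 K) : K) •
      (ContinuousLinearMap.proj (R := ℂ) (φ := fun _ : Fin t ↦ ℂ) j).comp
        (ContinuousLinearMap.snd ℂ _ _))

lemma Datum.linearPart_apply (X : Datum K s t) (g : X.Γ) (v : Model s t) : X.linearPart g v =
    (fun i ↦ (X.σ i ((g.unit : 𝓞 K) : K) : ℂ) * v.1 i,
      fun j ↦ X.τ j ((g.unit : 𝓞 K) : K) * v.2 j) := rfl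

lemma Datum.hasFDerivAt_affine (X : Datum K s t) (g : X.Γ) (z : Model s t) :
    HasFDerivAt (X.affine g) ((X.linearPart g).restrictScalars ℝ) z := by
  have h : X.affine g = fun z ↦ (X.linearPart g).restrictScalars ℝ z +
      ((fun i ↦ (X.σ i (g.int : K) : ℂ), fun j ↦ X.τ j (g.int : K)) : Model s t) := rfl
  rw [h]
  exact ((X.linearPart g).restrictScalars ℝ).hasFDerivAt.add_const _

/-- A self-map of `Hˢ × ℂᵗ` has the same derivative as a map of the ambient vector space that
extends it. -/
lemma hasMFDerivAt_domain {T : domain s t → domain s t} {A : Model s t → Model s t}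
    (hT : ∀ p, (T p : Model s t) = A p) {A' : Model s t →L[ℝ] Model s t} {p : domain s t}
    (hA : HasFDerivAt A A' p) :
    HasMFDerivAt 𝓘(ℝ, Model s t) 𝓘(ℝ, Model s t) T p A' := by
  refine ⟨?_, ?_⟩
  · rw [Topology.IsInducing.subtypeVal.continuousAt_iff]
    change ContinuousAt (fun p ↦ (T p : Model s t)) p
    simp only [hT]
    exact hA.continuousAt.comp continuousAt_subtype_val
  · refine HasFDerivAt.hasFDerivWithinAt ?_
    refine hA.congr_of_eventuallyEq ?_
    filter_upwards [eventually_chartAt_domain_symm p] with z hz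
    change ((T ((chartAt (Model s t) p).symm z) : domain s t) : Model s t) = _
    rw [hT, hz]

lemma hasMFDerivAt_chartAt_domain_symm (p : domain s t) :
    HasMFDerivAt 𝓘(ℝ, Model s t) 𝓘(ℝ, Model s t) (chartAt (Model s t) p).symm (p : Model s t)
      (ContinuousLinearMap.id ℝ (Model s t)) := by
  refine ⟨(chartAt (Model s t) p).symm.continuousAt (mem_chart_target (Model s t) p),
    HasFDerivAt.hasFDerivWithinAt ((hasFDerivAt_id _).congr_of_eventuallyEq ?_)⟩
  exact eventually_chartAt_domain_symm p

lemma Datum.exists_hasMFDerivAt_proj (X : Datum K s t) (p : domain s t) : ∃ g : X.Γ,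
    HasMFDerivAt 𝓘(ℝ, Model s t) 𝓘(ℝ, Model s t) X.proj p
      ((X.linearPart g).restrictScalars ℝ) := by
  obtain ⟨g, -, h, -⟩ := X.exists_chartAt_proj p
  refine ⟨g, continuous_quot_mk.continuousAt, HasFDerivAt.hasFDerivWithinAt ?_⟩
  refine (X.hasFDerivAt_affine g p).congr_of_eventuallyEq ?_
  filter_upwards [(continuousAt_chartAt_domain_symm p).eventually h,
    eventually_chartAt_domain_symm p] with z hz hz'
  change chartAt (Model s t) (X.proj p) (X.proj ((chartAt (Model s t) p).symm z)) = _
  rw [hz, hz']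

lemma Datum.contMDiff_proj (X : Datum K s t) :
    ContMDiff 𝓘(ℝ, Model s t) 𝓘(ℝ, Model s t) ∞ X.proj := fun p ↦ by
  obtain ⟨g, -, h, -⟩ := X.exists_chartAt_proj p
  refine contMDiffAt_iff.2 ⟨continuous_quot_mk.continuousAt, ContDiffAt.contDiffWithinAt ?_⟩
  have hA : ContDiffAt ℝ ∞ (X.affine g) p :=
    ((X.contDiff_affine g).restrict_scalars ℝ).contDiffAt.of_le le_top
  refine hA.congr_of_eventuallyEq ?_
  filter_upwards [(continuousAt_chartAt_domain_symm p).eventually h,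
    eventually_chartAt_domain_symm p] with z hz hz'
  change chartAt (Model s t) (X.proj p) (X.proj ((chartAt (Model s t) p).symm z)) = _
  rw [hz, hz']

lemma Datum.hasMFDerivAt_proj (X : Datum K s t) (p : domain s t) :
    HasMFDerivAt 𝓘(ℝ, Model s t) 𝓘(ℝ, Model s t) X.proj p
      (mfderiv 𝓘(ℝ, Model s t) 𝓘(ℝ, Model s t) X.proj p) :=
  (X.exists_hasMFDerivAt_proj p).choose_spec.mdifferentiableAt.hasMFDerivAt

lemma Datum.exists_mfderiv_proj (X : Datum K s t) (p : domain s t) : ∃ g : X.Γ,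
    mfderiv 𝓘(ℝ, Model s t) 𝓘(ℝ, Model s t) X.proj p = (X.linearPart g).restrictScalars ℝ :=
  (X.exists_hasMFDerivAt_proj p).imp fun _ h ↦ h.mfderiv

lemma Datum.mfderiv_proj_smul (X : Datum K s t) (g : X.Γ) (p : domain s t) (v : Model s t) :
    mfderiv 𝓘(ℝ, Model s t) 𝓘(ℝ, Model s t) X.proj (g • p) (X.linearPart g v) =
      mfderiv 𝓘(ℝ, Model s t) 𝓘(ℝ, Model s t) X.proj p v := by
  have h1 := (X.hasMFDerivAt_proj (g • p)).comp p
    (hasMFDerivAt_domain (T := fun p ↦ g • p) (fun p ↦ X.coe_smul g p) (X.hasFDerivAt_affine g p))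
  have h2 : X.proj ∘ (fun p ↦ g • p) = X.proj := funext fun p ↦
    Quotient.sound ⟨g, rfl⟩
  rw [h2] at h1
  exact (DFunLike.congr_fun h1.mfderiv v).symm

end Projection

end OeljeklausToma

end

noncomputable section

namespace OeljeklausToma

open ComplexManifold

/-! ### The lift of a form as a form on the ambient vector space -/

section Lift

set_option linter.unusedSectionVars false

variable {K : Type*} [Field K] [NumberField K] {s t : ℕ}
  {F : Type*} [NormedAddCommGroup F] [NormedSpace ℝ F] {n : ℕ}

open Classical in
/-- The lift to `Hˢ × ℂᵗ` of a form on `X(K, U)`, extended by zero to `ℂˢ × ℂᵗ`. -/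
def Datum.liftExt (X : Datum K s t) (η : DForm (Model s t) X.Manifold F n) :
    Model s t → Model s t [⋀^Fin n]→L[ℝ] F := fun z ↦
  if h : z ∈ domain s t then X.lift η ⟨z, h⟩ else 0

lemma Datum.liftExt_of_mem (X : Datum K s t) (η : DForm (Model s t) X.Manifold F n)
    {z : Model s t} (h : z ∈ domain s t) : X.liftExt η z = X.lift η ⟨z, h⟩ := dif_pos h

lemma Datum.liftExt_of_notMem (X : Datum K s t) (η : DForm (Model s t) X.Manifold F n)
    {z : Model s t} (h : z ∉ domain s t) : X.liftExt η z = 0 := dif_neg h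

/-- Values of a form at equal points, with all tangent spaces identified with `ℂˢ × ℂᵗ`. -/
lemma DForm_congr {X : Datum K s t} (η : DForm (Model s t) X.Manifold F n) {x y : X.Manifold}
    (h : x = y) {v w : Fin n → Model s t} (hvw : v = w) :
    (η x : Model s t [⋀^Fin n]→L[ℝ] F) v = (η y : Model s t [⋀^Fin n]→L[ℝ] F) w := by
  subst h hvw
  rfl

lemma Datum.lift_apply (X : Datum K s t) (η : DForm (Model s t) X.Manifold F n) (p : domain s t)
    (v : Fin n → Model s t) : X.lift η p v =
      η (X.proj p) (fun i ↦ mfderiv 𝓘(ℝ, Model s t) 𝓘(ℝ, Model s t) X.proj p (v i)) := rfl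

/-- The lift of a form is invariant under `U ⋉ 𝓞 K`. -/
lemma Datum.lift_smul (X : Datum K s t) (η : DForm (Model s t) X.Manifold F n) (g : X.Γ)
    (p : domain s t) (v : Fin n → Model s t) :
    X.lift η (g • p) (fun i ↦ X.linearPart g (v i)) = X.lift η p v := by
  exact DForm_congr η (Quotient.sound ⟨g, rfl⟩) (funext fun i ↦ X.mfderiv_proj_smul g p (v i))

lemma Datum.affine_mem_iff (X : Datum K s t) (g : X.Γ) {z : Model s t} :
    X.affine g z ∈ domain s t ↔ z ∈ domain s t := by
  refine ⟨fun h i ↦ ?_, fun h ↦ X.affine_mem g h⟩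
  have := h i
  simp only [Datum.affine, Complex.add_im, Complex.im_ofReal_mul, Complex.ofReal_im,
    add_zero] at this
  exact (pos_iff_pos_of_mul_pos this).1 (X.U_pos _ g.unit_mem i)

lemma Datum.liftExt_affine (X : Datum K s t) (η : DForm (Model s t) X.Manifold F n) (g : X.Γ)
    (z : Model s t) : X.liftExt η z =
      (X.liftExt η (X.affine g z)).compContinuousLinearMap
        ((X.linearPart g).restrictScalars ℝ) := by
  by_cases hz : z ∈ domain s t
  · rw [X.liftExt_of_mem η hz, X.liftExt_of_mem η (X.affine_mem g hz)]
    exact ContinuousAlternatingMap.ext fun v ↦ (X.lift_smul η g ⟨z, hz⟩ v).symm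
  · rw [X.liftExt_of_notMem η hz, X.liftExt_of_notMem η (mt (X.affine_mem_iff g).1 hz)]
    rfl

lemma Datum.liftExt_comp_mulI (X : Datum K s t) {η : DForm (Model s t) X.Manifold F 2}
    (hη : η.IsOneOne) (z : Model s t) :
    (X.liftExt η z).compContinuousLinearMap (mulI _) = X.liftExt η z := by
  by_cases hz : z ∈ domain s t
  · rw [X.liftExt_of_mem η hz]
    obtain ⟨g, hg⟩ := X.exists_mfderiv_proj ⟨z, hz⟩
    refine ContinuousAlternatingMap.ext fun v ↦ ?_
    have h1 := hη (X.proj ⟨z, hz⟩) (X.linearPart g (v 0)) (X.linearPart g (v 1))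
    have h2 : ∀ v : Fin 2 → Model s t, X.lift η ⟨z, hz⟩ v =
        η (X.proj ⟨z, hz⟩) ![X.linearPart g (v 0), X.linearPart g (v 1)] := fun v ↦ by
      rw [Datum.lift_apply, hg]
      congr 1
      ext i : 1
      fin_cases i <;> rfl
    refine (h2 fun i ↦ mulI _ (v i)).trans (Eq.trans ?_ (h1.trans (h2 v).symm))
    congr 1
    ext i : 1
    fin_cases i <;> exact (X.linearPart g).map_smul _ _
  · rw [X.liftExt_of_notMem η hz]
    rfl

/-- In the preferred chart at `proj p`, a form on `X(K, U)` is given by its lift. -/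
lemma Datum.eventually_pullback_chartAt_symm (X : Datum K s t)
    (η : DForm (Model s t) X.Manifold F n) (p : domain s t) : ∃ g : X.Γ,
    chartAt (Model s t) (X.proj p) (X.proj p) = X.affine g p ∧
    ∀ᶠ z in 𝓝 (X.affine g p), (DForm.pullback (E := Model s t) (E' := Model s t)
      (chartAt (Model s t) (X.proj p)).symm η z : Model s t [⋀^Fin n]→L[ℝ] F) =
        X.liftExt η z := by
  obtain ⟨g, hg, -, h⟩ := X.exists_chartAt_proj p
  refine ⟨g, hg, ?_⟩
  filter_upwards [h.eventually_nhds] with z hz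
  obtain ⟨hzD, hz0⟩ := hz.self_of_nhds
  rw [X.liftExt_of_mem η hzD]
  have hproj : ∀ q, q = ⟨z, hzD⟩ → HasMFDerivAt 𝓘(ℝ, Model s t) 𝓘(ℝ, Model s t) X.proj q
      (mfderiv 𝓘(ℝ, Model s t) 𝓘(ℝ, Model s t) X.proj ⟨z, hzD⟩ :
        Model s t →L[ℝ] Model s t) := by
    rintro _ rfl
    exact X.hasMFDerivAt_proj _
  have hc := chartAt_domain_symm ⟨z, hzD⟩ (mem_chart_target (Model s t) (⟨z, hzD⟩ : domain s t))
  have hder := (hproj _ (Subtype.ext hc)).comp z (hasMFDerivAt_chartAt_domain_symm ⟨z, hzD⟩)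
  have hder' := hder.congr_of_eventuallyEq (f₁ := (chartAt (Model s t) (X.proj p)).symm) (by
    filter_upwards [hz, eventually_chartAt_domain_symm ⟨z, hzD⟩] with y ⟨hyD, hy⟩ hy'
    rw [hy, Function.comp_apply]
    congr 1
    exact Subtype.ext hy'.symm)
  refine ContinuousAlternatingMap.ext fun v ↦ DForm_congr η hz0 (funext fun i ↦ ?_)
  exact DFunLike.congr_fun hder'.mfderiv (v i)

/-- The definition of `η.ddc = 0` uses one chart at each point of the quotient; the invariance of the
lift extends the equation to the whole orbit. -/
lemma Datum.localDdc_liftExt (X : Datum K s t) {η : DForm (Model s t) X.Manifold F 2}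
    (hη : η.IsOneOne) (hddc : η.ddc = 0) (hsmooth : ContDiffOn ℝ 2 (X.liftExt η) (domain s t))
    {z : Model s t} (hz : z ∈ domain s t) : localDdc (X.liftExt η) z = 0 := by
  obtain ⟨g, hg, h⟩ := X.eventually_pullback_chartAt_symm η ⟨z, hz⟩
  have h1 : localDdc (X.liftExt η) (X.affine g z) = 0 := by
    have h2 : localDdc (E := Model s t) (DForm.pullback (E := Model s t) (E' := Model s t)
        (chartAt (Model s t) (X.proj ⟨z, hz⟩)).symm η)
        (chartAt (Model s t) (X.proj ⟨z, hz⟩) (X.proj ⟨z, hz⟩)) = 0 :=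
      congrFun hddc (X.proj ⟨z, hz⟩)
    rw [hg] at h2
    rw [← h2]
    have h3 : X.liftExt η =ᶠ[𝓝 (X.affine g z)] DForm.pullback (E := Model s t)
        (E' := Model s t) (chartAt (Model s t) (X.proj ⟨z, hz⟩)).symm η :=
      h.mono fun _ h ↦ h.symm
    exact localDdc_congr h3
  rw [localDdc_comp_affine (domain s t).isOpen (fun z _ ↦ X.liftExt_comp_mulI hη z) hsmooth
    (X.hasFDerivAt_affine g) (fun z hz ↦ X.affine_mem g hz)
    (fun z _ ↦ X.liftExt_affine η g z) hz, h1]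
  rfl

/-- A form on an open set is smooth if its values on all families of constant vectors are. -/
lemma contDiffOn_of_apply {V : Type*} [NormedAddCommGroup V] [NormedSpace ℝ V]
    [FiniteDimensional ℝ V] [FiniteDimensional ℝ F] {D : Set V}
    {Ω : V → V [⋀^Fin n]→L[ℝ] F} {k : WithTop ℕ∞}
    (h : ∀ v : Fin n → V, ContDiffOn ℝ k (fun z ↦ Ω z v) D) : ContDiffOn ℝ k Ω D := by
  let B := Module.finBasis ℝ V
  let T : V [⋀^Fin n]→L[ℝ] F →ₗ[ℝ] ((Fin n → Fin (Module.finrank ℝ V)) → F) :=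
    LinearMap.pi fun k ↦ (ContinuousAlternatingMap.apply ℝ V F fun i ↦ B (k i)).toLinearMap
  have hT : LinearMap.ker T = ⊥ := by
    refine LinearMap.ker_eq_bot'.2 fun α hα ↦ ?_
    have : α.toAlternatingMap.toMultilinearMap = 0 :=
      Module.Basis.ext_multilinear (fun _ ↦ B) fun k ↦ congrFun hα k
    exact ContinuousAlternatingMap.ext fun v ↦ congrArg (fun f ↦ f v) this
  obtain ⟨S, hS⟩ := T.exists_leftInverse_of_injective hT
  have h1 : ContDiffOn ℝ k (fun z ↦ T (Ω z)) D := contDiffOn_pi.2 fun k ↦ h _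
  have h2 := S.toContinuousLinearMap.contDiff.comp_contDiffOn h1
  refine h2.congr fun z _ ↦ ?_
  exact (LinearMap.congr_fun hS (Ω z)).symm

end Lift

end OeljeklausToma

end

noncomputable section

namespace OeljeklausToma

open ComplexManifold

/-! ### Lifts of Hermitian metrics -/

section Hermitian

variable {K : Type*} [Field K] [NumberField K] {s t : ℕ}

instance (X : Datum K s t) : IsManifold 𝓘(ℝ, Model s t) 1 X.Manifold :=
  IsManifold.of_le (n := ∞) (by simp)

/-- The images in `X(K, U)` of a constant vector field on `Hˢ × ℂᵗ` form a smooth vector field along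
the projection: in charts the field is locally constant, since the projection is locally affine. -/
lemma Datum.contMDiff_mfderiv_proj (X : Datum K s t) (v : Model s t) :
    ContMDiff 𝓘(ℝ, Model s t) (𝓘(ℝ, Model s t).prod 𝓘(ℝ, Model s t)) ∞
      (fun p : domain s t ↦ Bundle.TotalSpace.mk' (Model s t)
        (E := fun x : X.Manifold ↦ TangentSpace 𝓘(ℝ, Model s t) x) (X.proj p)
        (mfderiv 𝓘(ℝ, Model s t) 𝓘(ℝ, Model s t) X.proj p v)) := fun p ↦ by
  refine (Bundle.contMDiffAt_totalSpace).2 ⟨X.contMDiff_proj p, ?_⟩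
  obtain ⟨g, -, h, -⟩ := X.exists_chartAt_proj p
  have hsrc : ∀ᶠ p' in 𝓝 p, X.proj p' ∈ (chartAt (Model s t) (X.proj p)).source :=
    (X.contMDiff_proj.continuous.continuousAt).eventually
      (chart_source_mem_nhds (Model s t) (X.proj p))
  refine (contMDiffAt_const (c := X.linearPart g v)).congr_of_eventuallyEq ?_
  filter_upwards [hsrc, h.eventually_nhds] with p' hp' hp''
  have h1 := TangentBundle.continuousLinearMapAt_trivializationAt
    (I := 𝓘(ℝ, Model s t)) hp'
  have h2 := (mdifferentiableAt_extChartAt (I := 𝓘(ℝ, Model s t)) hp').hasMFDerivAt.comp p'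
    (X.hasMFDerivAt_proj p')
  have h3 : HasMFDerivAt 𝓘(ℝ, Model s t) 𝓘(ℝ, Model s t)
      (fun p : domain s t ↦ X.affine g p) p' ((X.linearPart g).restrictScalars ℝ) := by
    refine ⟨?_, HasFDerivAt.hasFDerivWithinAt ?_⟩
    · exact (X.hasFDerivAt_affine g p').continuousAt.comp continuousAt_subtype_val
    · refine (X.hasFDerivAt_affine g p').congr_of_eventuallyEq ?_
      filter_upwards [eventually_chartAt_domain_symm p'] with z hz
      change X.affine g ((chartAt (Model s t) p').symm z) = _
      rw [hz]
  have h4 := h3.congr_of_eventuallyEq (f₁ := extChartAt 𝓘(ℝ, Model s t) (X.proj p) ∘ X.proj) hp''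
  have h5 := hasMFDerivAt_unique h2 h4
  have h6 := DFunLike.congr_fun h5 v
  rw [← h1] at h6
  refine Eq.trans ?_ h6
  exact (Bundle.Trivialization.continuousLinearMapAt_apply_of_mem ℝ
    (trivializationAt (Model s t) (TangentSpace 𝓘(ℝ, Model s t)) (X.proj p)) hp' _).symm

/-- The lift of a metric has smooth coefficients on `Hˢ × ℂᵗ`. -/
lemma Datum.contMDiff_inner_mfderiv_proj (X : Datum K s t)
    (g : HermitianMetric (Model s t) X.Manifold) (v w : Model s t) :
    ContMDiff 𝓘(ℝ, Model s t) 𝓘(ℝ, ℝ) ∞ (fun p : domain s t ↦ g.inner (X.proj p)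
      (mfderiv 𝓘(ℝ, Model s t) 𝓘(ℝ, Model s t) X.proj p v)
      (mfderiv 𝓘(ℝ, Model s t) 𝓘(ℝ, Model s t) X.proj p w)) := fun p ↦ by
  have h : ContMDiffAt 𝓘(ℝ, Model s t) (𝓘(ℝ, Model s t).prod 𝓘(ℝ)) ∞
      (fun p : domain s t ↦ Bundle.TotalSpace.mk' ℝ (E := Bundle.Trivial X.Manifold ℝ) (X.proj p)
        (g.inner (X.proj p) (mfderiv 𝓘(ℝ, Model s t) 𝓘(ℝ, Model s t) X.proj p v)
          (mfderiv 𝓘(ℝ, Model s t) 𝓘(ℝ, Model s t) X.proj p w))) p := by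
    apply ContMDiffAt.clm_bundle_apply₂ (F₁ := Model s t) (F₂ := Model s t)
    · exact ContMDiffAt.comp p g.contMDiff.contMDiffAt X.contMDiff_proj.contMDiffAt
    · exact X.contMDiff_mfderiv_proj v p
    · exact X.contMDiff_mfderiv_proj w p
  exact (Bundle.contMDiffAt_totalSpace.1 h).2

/-- Multiplication by `i` on `ℂˢ × ℂᵗ` corresponds to the complex structure of `X(K, U)`, since the
elements of `U ⋉ 𝓞 K` act by complex affine maps. -/
lemma Datum.mfderiv_proj_I_smul (X : Datum K s t) (p : domain s t) (v : Model s t) :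
    mfderiv 𝓘(ℝ, Model s t) 𝓘(ℝ, Model s t) X.proj p (Complex.I • v) =
      J (Model s t) (X.proj p) (mfderiv 𝓘(ℝ, Model s t) 𝓘(ℝ, Model s t) X.proj p v) := by
  obtain ⟨g, hg⟩ := X.exists_mfderiv_proj p
  rw [hg]
  exact (X.linearPart g).map_smul Complex.I v

lemma Datum.lift_fundamentalForm (X : Datum K s t) (g : HermitianMetric (Model s t) X.Manifold)
    (p : domain s t) (v : Fin 2 → Model s t) : X.lift g.fundamentalForm p v =
      g.inner (X.proj p)
        (mfderiv 𝓘(ℝ, Model s t) 𝓘(ℝ, Model s t) X.proj p (Complex.I • v 0))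
        (mfderiv 𝓘(ℝ, Model s t) 𝓘(ℝ, Model s t) X.proj p (v 1)) := by
  rw [X.mfderiv_proj_I_smul]
  rfl

lemma Datum.contDiffOn_liftExt_fundamentalForm (X : Datum K s t)
    (g : HermitianMetric (Model s t) X.Manifold) :
    ContDiffOn ℝ 2 (X.liftExt g.fundamentalForm) (domain s t) := by
  refine contDiffOn_of_apply fun v z hz ↦ ContDiffAt.contDiffWithinAt ?_
  have h := (contMDiffAt_iff.1
    (X.contMDiff_inner_mfderiv_proj g (Complex.I • v 0) (v 1) ⟨z, hz⟩)).2
  have h' : ContDiffAt ℝ ∞ (fun y ↦ g.inner (X.proj ((chartAt (Model s t) ⟨z, hz⟩).symm y))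
      (mfderiv 𝓘(ℝ, Model s t) 𝓘(ℝ, Model s t) X.proj
        ((chartAt (Model s t) ⟨z, hz⟩).symm y) (Complex.I • v 0))
      (mfderiv 𝓘(ℝ, Model s t) 𝓘(ℝ, Model s t) X.proj
        ((chartAt (Model s t) ⟨z, hz⟩).symm y) (v 1))) z :=
    contDiffWithinAt_univ.1 (by simpa using! h)
  refine (h'.of_le (by norm_cast)).congr_of_eventuallyEq ?_
  filter_upwards [eventually_chartAt_domain_symm ⟨z, hz⟩,
    (domain s t).isOpen.mem_nhds hz] with y hy hyD
  rw [X.liftExt_of_mem _ hyD]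
  have : (⟨y, hyD⟩ : domain s t) = (chartAt (Model s t) ⟨z, hz⟩).symm y := Subtype.ext hy.symm
  rw [this]
  exact X.lift_fundamentalForm g _ v

lemma fundamentalForm_isOneOne {X : Datum K s t} (g : HermitianMetric (Model s t) X.Manifold) :
    g.fundamentalForm.IsOneOne := fun x v w ↦ by
  simp only [HermitianMetric.fundamentalForm_apply, g.inner_J]

/-- The fundamental form of a Hermitian metric is positive on complex lines. -/
lemma Datum.lift_fundamentalForm_pos (X : Datum K s t)
    (g : HermitianMetric (Model s t) X.Manifold) (p : domain s t) {v : Model s t} (hv : v ≠ 0) :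
    0 < X.lift g.fundamentalForm p ![v, Complex.I • v] := by
  refine lt_of_lt_of_eq ?_ (X.lift_fundamentalForm g p ![v, Complex.I • v]).symm
  refine g.pos _ _ fun h0 ↦ hv ?_
  obtain ⟨a, ha⟩ := X.exists_mfderiv_proj p
  rw [ha] at h0
  have h1 : X.linearPart a (Complex.I • v) = 0 := h0
  rw [map_smul, smul_eq_zero_iff_right Complex.I_ne_zero, X.linearPart_apply, Prod.mk_eq_zero] at h1
  have hne : ((a.unit : 𝓞 K) : K) ≠ 0 := by simp
  refine Prod.ext (funext fun i ↦ ?_) (funext fun j ↦ ?_)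
  · simpa using congrFun h1.1 i
  · simpa using congrFun h1.2 j

end Hermitian

end OeljeklausToma

end

noncomputable section

namespace OeljeklausToma

open ComplexManifold

/-! ### Lifts of left-invariant forms -/

section LeftInvariantForms

variable {s : ℕ}

/-- The eigenvalue of `φ(r)` on the factor `ℂ`. -/
def solvChar (c r : Fin s → ℝ) : ℂ :=
  Complex.exp (-(∑ i, r i) / 2 + Complex.I * ∑ i, c i * r i)

lemma norm_solvChar_sq (c r : Fin s → ℝ) : ‖solvChar c r‖ ^ 2 = Real.exp (-∑ i, r i) := by
  rw [solvChar, Complex.norm_exp, ← Real.exp_nat_mul]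
  have h2 : -((∑ i, r i : ℝ) : ℂ) / 2 = ((-(∑ i, r i) / 2 : ℝ) : ℂ) := by simp
  rw [h2, Complex.add_re, Complex.ofReal_re, mul_comm Complex.I, Complex.re_ofReal_mul,
    Complex.I_re]
  congr 1
  push_cast
  ring

/-- The linear map `φ(r)`. -/
def solvLinear (c r : Fin s → ℝ) : Model s 1 →L[ℂ] Model s 1 :=
  (ContinuousLinearMap.pi fun i ↦ (Real.exp (r i) : ℂ) •
      (ContinuousLinearMap.proj (R := ℂ) (φ := fun _ : Fin s ↦ ℂ) i).comp
        (ContinuousLinearMap.fst ℂ _ _)).prod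
    (ContinuousLinearMap.pi fun j ↦ solvChar c r •
      (ContinuousLinearMap.proj (R := ℂ) (φ := fun _ : Fin 1 ↦ ℂ) j).comp
        (ContinuousLinearMap.snd ℂ _ _))

lemma solvLinear_apply (c r : Fin s → ℝ) (v : Model s 1) : solvLinear c r v =
    (fun i ↦ (Real.exp (r i) : ℂ) * v.1 i, fun j ↦ solvChar c r * v.2 j) := rfl

lemma solvLinear_neg (c r : Fin s → ℝ) (v : Model s 1) :
    solvLinear c r (solvLinear c (-r) v) = v := by
  have h1 : ∀ i, (Real.exp (r i) : ℂ) * (Real.exp ((-r) i) : ℂ) = 1 := fun i ↦ by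
    rw [← Complex.ofReal_mul, ← Real.exp_add]
    simp
  have h2 : solvChar c r * solvChar c (-r) = 1 := by
    rw [solvChar, solvChar, ← Complex.exp_add, Complex.exp_eq_one_iff]
    exact ⟨0, by simp; ring⟩
  simp only [solvLinear_apply, ← mul_assoc, h1, h2, one_mul]

lemma hasFDerivAt_solvAffine (c r u : Fin s → ℝ) (v : ℂ) (z : Model s 1) :
    HasFDerivAt (solvAffine c r u v) ((solvLinear c r).restrictScalars ℝ) z := by
  have h : solvAffine c r u v = fun z ↦ (solvLinear c r).restrictScalars ℝ z +
      ((fun i ↦ (u i : ℂ), fun _ ↦ v) : Model s 1) := rfl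
  rw [h]
  exact ((solvLinear c r).restrictScalars ℝ).hasFDerivAt.add_const _

/-- The base point `(i, …, i, 0)` of `Hˢ × ℂ`. -/
def basePoint (s : ℕ) : domain s 1 := ⟨(fun _ ↦ Complex.I, 0), fun _ ↦ by simp⟩

lemma solvTranslation_basePoint (c : Fin s → ℝ) (p : domain s 1) :
    solvTranslation c (fun i ↦ Real.log ((p : Model s 1).1 i).im)
      (fun i ↦ ((p : Model s 1).1 i).re) ((p : Model s 1).2 0) (basePoint s) = p := by
  refine Subtype.ext (Prod.ext (funext fun i ↦ ?_) (funext fun j ↦ ?_))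
  · have : 0 < ((p : Model s 1).1 i).im := p.2 i
    simp only [solvTranslation, solvAffine, basePoint, Real.exp_log this]
    rw [add_comm, Complex.re_add_im]
  · simp [solvTranslation, solvAffine, basePoint, Subsingleton.elim j 0]

variable {K : Type*} [Field K] [NumberField K] {n : ℕ}

lemma IsLeftInvariant.lift_solvTranslation {X : Datum K s 1} {c : Fin s → ℝ}
    {η : DForm (Model s 1) X.Manifold ℂ n} (h : IsLeftInvariant X c η) (r u : Fin s → ℝ) (v : ℂ)
    (p : domain s 1) (w : Fin n → Model s 1) :
    X.lift η (solvTranslation c r u v p) (fun i ↦ solvLinear c r (w i)) = X.lift η p w := by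
  have h1 := congrArg (fun α : DForm (Model s 1) (domain s 1) ℂ n ↦ α p w) (h r u v)
  refine Eq.trans ?_ h1
  have h2 := (hasMFDerivAt_domain (T := solvTranslation c r u v) (fun p ↦ rfl)
    (hasFDerivAt_solvAffine c r u v p)).mfderiv
  change _ = X.lift η (solvTranslation c r u v p) (fun i ↦
    mfderiv 𝓘(ℝ, Model s 1) 𝓘(ℝ, Model s 1) (solvTranslation c r u v) p (w i))
  rw [h2]
  rfl

lemma IsLeftInvariant.liftExt_apply {X : Datum K s 1} {c : Fin s → ℝ}
    {η : DForm (Model s 1) X.Manifold ℂ n} (h : IsLeftInvariant X c η) {z : Model s 1}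
    (hz : z ∈ domain s 1) (w : Fin n → Model s 1) :
    X.liftExt η z w = X.liftExt η (basePoint s)
      (fun i ↦ solvLinear c (-fun i ↦ Real.log (z.1 i).im) (w i)) := by
  rw [X.liftExt_of_mem η hz, X.liftExt_of_mem η (basePoint s).2]
  have h1 := h.lift_solvTranslation (fun i ↦ Real.log (z.1 i).im) (fun i ↦ (z.1 i).re) (z.2 0)
    (basePoint s) (fun i ↦ solvLinear c (-fun i ↦ Real.log (z.1 i).im) (w i))
  simp only [solvLinear_neg] at h1
  rw [solvTranslation_basePoint c ⟨z, hz⟩] at h1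
  exact h1

/-- The lift of a left-invariant form is smooth, because the group `G` acts transitively. -/
lemma IsLeftInvariant.contDiffOn_liftExt {X : Datum K s 1} {c : Fin s → ℝ}
    {η : DForm (Model s 1) X.Manifold ℂ n} (h : IsLeftInvariant X c η) :
    ContDiffOn ℝ 2 (X.liftExt η) (domain s 1) := by
  refine contDiffOn_of_apply fun w ↦ ContDiffOn.congr ?_ fun z hz ↦ h.liftExt_apply hz w
  refine (X.liftExt η (basePoint s)).toContinuousMultilinearMap.contDiff.comp_contDiffOn ?_
  have hlog : ∀ i, ContDiffOn ℝ 2 (fun z : Model s 1 ↦ -Real.log (z.1 i).im) (domain s 1) :=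
    fun i ↦ (ContDiffOn.log (Complex.imCLM.contDiff.comp (by fun_prop)).contDiffOn
      fun z hz ↦ (hz i).ne').neg
  have hre : ∀ {f : Model s 1 → ℝ}, ContDiffOn ℝ 2 f (domain s 1) →
      ContDiffOn ℝ 2 (fun z ↦ (f z : ℂ)) (domain s 1) := fun hf ↦
    Complex.ofRealCLM.contDiff.comp_contDiffOn hf
  refine contDiffOn_pi.2 fun k ↦ ContDiffOn.prodMk (contDiffOn_pi.2 fun i ↦ ?_)
    (contDiffOn_pi.2 fun j ↦ ?_)
  · exact (hre (hlog i).exp).mul contDiffOn_const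
  · refine ContDiffOn.mul (ContDiffOn.cexp ?_) contDiffOn_const
    refine ContDiffOn.add ?_ ?_
    · exact (hre (ContDiffOn.sum fun i _ ↦ hlog i)).neg.div_const 2
    · exact contDiffOn_const.mul (hre (ContDiffOn.sum fun i _ ↦ contDiffOn_const.mul (hlog i)))

end LeftInvariantForms

end OeljeklausToma

end

noncomputable section

namespace OeljeklausToma

open ComplexManifold MeasureTheory Set

/-! ### The component of a form along the factor `ℂ` -/

section Component

variable {s : ℕ}

/-- The inclusion of `ℝˢ × ℂ` in `ℂˢ × ℂ`; the translations by its image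
belong to `G`. -/
def realIncl (s : ℕ) : (Fin s → ℝ) × (Fin 1 → ℂ) →L[ℝ] Model s 1 :=
  ContinuousLinearMap.prodMap
    (ContinuousLinearMap.pi fun i ↦ Complex.ofRealCLM.comp (ContinuousLinearMap.proj i))
    (ContinuousLinearMap.id ℝ _)

lemma realIncl_apply (x : (Fin s → ℝ) × (Fin 1 → ℂ)) :
    realIncl s x = (fun i ↦ (x.1 i : ℂ), x.2) := rfl

/-- The vector `(1, …, 1; 0)`, tangent to the diagonal of `Hˢ`. -/
def diagVec (s : ℕ) : Model s 1 := (fun _ ↦ 1, 0)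

/-- The vector `(0; 1)`, tangent to the factor `ℂ`. -/
def lineVec (s : ℕ) : Model s 1 := (0, fun _ ↦ 1)

lemma diag_add_realIncl (t : ℝ) (x : (Fin s → ℝ) × (Fin 1 → ℂ)) :
    t • Complex.I • diagVec s + realIncl s x =
      (fun i ↦ (x.1 i : ℂ) + t * Complex.I, x.2) := by
  refine Prod.ext (funext fun i ↦ ?_) (funext fun j ↦ ?_) <;>
  simp [diagVec, realIncl_apply, add_comm]

lemma diag_add_realIncl_mem {t : ℝ} (ht : 0 < t) (x : (Fin s → ℝ) × (Fin 1 → ℂ)) :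
    t • Complex.I • diagVec s + realIncl s x ∈ domain s 1 := fun i ↦ by
  rw [diag_add_realIncl]
  simpa using ht

/-- On a complex line, a real alternating form is a multiple of the area form. -/
lemma alternating_smul_lineVec {F : Type*} [NormedAddCommGroup F] [NormedSpace ℝ F]
    (α : Model s 1 [⋀^Fin 2]→L[ℝ] F) (z z' : ℂ) :
    α ![z • lineVec s, z' • lineVec s] =
      (z.re * z'.im - z.im * z'.re) • α ![lineVec s, Complex.I • lineVec s] := by
  have hz : ∀ z : ℂ, z • lineVec s = z.re • lineVec s + z.im • Complex.I • lineVec s := fun z ↦ by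
    conv_lhs => rw [← Complex.re_add_im z, add_smul, mul_smul]
    rw [Complex.coe_smul, Complex.coe_smul]
  generalize lineVec s = e at *
  have hanti : ∀ v w, α ![v, w] = -α ![w, v] := fun v w ↦ by
    rw [← alternating_neg_swap α w v, ← neg_one_smul ℝ v, α.vecCons_smul, neg_one_smul, neg_neg]
  have hself : ∀ v, α ![v, v] = 0 := fun v ↦
    α.map_eq_zero_of_eq _ (i := 0) (j := 1) rfl (by decide)
  have hadd : ∀ u v w, α ![u, v + w] = α ![u, v] + α ![u, w] := fun u v w ↦ by
    rw [hanti, α.vecCons_add, hanti v, hanti w, neg_add, neg_neg, neg_neg]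
  have hsmul : ∀ (a : ℝ) u v, α ![u, a • v] = a • α ![u, v] := fun a u v ↦ by
    rw [hanti, α.vecCons_smul, hanti u, smul_neg]
  rw [hz z, hz z', α.vecCons_add, α.vecCons_smul, α.vecCons_smul, hadd, hadd, hsmul, hsmul, hsmul,
    hsmul, hself, hself, hanti (Complex.I • e) e]
  module

lemma alternating_smul_lineVec_I {F : Type*} [NormedAddCommGroup F] [NormedSpace ℝ F]
    (α : Model s 1 [⋀^Fin 2]→L[ℝ] F) (z : ℂ) :
    α ![z • lineVec s, Complex.I • z • lineVec s] =
      ‖z‖ ^ 2 • α ![lineVec s, Complex.I • lineVec s] := by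
  rw [smul_smul, alternating_smul_lineVec, Complex.sq_norm, Complex.normSq_apply]
  congr 1
  simp

/-- A power of degree at least `2` is not dominated by an affine function. -/
lemma eq_zero_of_mul_pow_le (hs : 2 ≤ s) {c a b : ℝ} (hc : 0 ≤ c)
    (h : ∀ t : ℝ, 0 < t → c * t ^ s ≤ a + t * b) : c = 0 := by
  by_contra hne
  have hc' : 0 < c := lt_of_le_of_ne hc (Ne.symm hne)
  -- at this `t ≥ 1`, already `c * t ^ 2 = t * (c + |a| + |b|)` exceeds `a + t * b`
  set t := 1 + (|a| + |b|) / c with ht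
  have hq : 0 ≤ (|a| + |b|) / c := by positivity
  have ht1 : 1 ≤ t := by linarith
  have h1 : c * t ^ 2 ≤ a + t * b :=
    (mul_le_mul_of_nonneg_left (pow_le_pow_right₀ ht1 hs) hc).trans (h t (by linarith))
  have h2 : c * t = c + (|a| + |b|) := by
    rw [ht]
    field_simp
  have h3 : c * t ^ 2 = t * c + t * |a| + t * |b| := by
    rw [sq, ← mul_assoc, h2]
    ring
  have h4 : |a| ≤ t * |a| := le_mul_of_one_le_left (abs_nonneg _) ht1
  have h5 : t * b ≤ t * |b| := mul_le_mul_of_nonneg_left (le_abs_self _) (by linarith)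
  have h6 : 0 < t * c := by positivity
  linarith [le_abs_self a]

variable {K : Type*} [Field K] [NumberField K]
  {F : Type*} [NormedAddCommGroup F] [NormedSpace ℝ F]

lemma Datum.liftExt_add_realIncl (X : Datum K s 1) {n : ℕ} (η : DForm (Model s 1) X.Manifold F n)
    (b : 𝓞 K) (z : Model s 1) : X.liftExt η (z + realIncl s (X.embed b)) = X.liftExt η z := by
  let g : X.Γ := (⟨Multiplicative.ofAdd b, 1⟩ : Multiplicative (𝓞 K) ⋊[unitsAct X.U] X.U)
  have hu : g.unit = 1 := rfl
  have hi : g.int = b := rfl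
  have h1 : X.affine g z = z + realIncl s (X.embed b) := by
    simp only [Datum.affine, hu, hi]
    refine Prod.ext (funext fun i ↦ ?_) (funext fun j ↦ ?_) <;>
    simp [realIncl_apply, Datum.embed]
  have h2 : X.linearPart g = ContinuousLinearMap.id ℂ _ := by
    refine ContinuousLinearMap.ext fun v ↦ ?_
    rw [X.linearPart_apply, hu]
    refine Prod.ext (funext fun i ↦ ?_) (funext fun j ↦ ?_) <;> simp
  rw [X.liftExt_affine η g z, h1, h2]
  rfl

/-- The averages along the diagonal of `Hˢ` of the component along `ℂ` of a `ddᶜ`-closed `(1,1)`-form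
are affine. -/
lemma Datum.exists_average_eq_affine [CompleteSpace F] (X : Datum K s 1)
    {η : DForm (Model s 1) X.Manifold F 2} (hη : η.IsOneOne) (hddc : η.ddc = 0)
    (hsmooth : ContDiffOn ℝ 2 (X.liftExt η) (domain s 1)) :
    ∃ (n : ℕ) (b : Fin (n + 1) → (Fin s → ℝ) × (Fin 1 → ℂ)) (A B : F), ∀ t : ℝ, 0 < t →
      ∫ θ in Icc (0 : Fin (n + 1) → ℝ) 1,
        X.liftExt η (t • Complex.I • diagVec s + realIncl s (∑ j, θ j • b j))
          ![lineVec s, Complex.I • lineVec s] = A + t • B := by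
  obtain ⟨n, b, hb, hspan⟩ := AddSubgroup.exists_fin_span_eq_top _ X.span_embed
  choose β hβ using hb
  have hrange : ∀ x, realIncl s x ∈ Submodule.span ℝ (range fun j ↦ realIncl s (b j)) := fun x ↦ by
    have : (range fun j ↦ realIncl s (b j)) = (realIncl s).toLinearMap '' range b := by
      rw [← range_comp]
      rfl
    rw [this, ← Submodule.map_span, hspan]
    exact ⟨x, trivial, rfl⟩
  obtain ⟨A, B, h⟩ := ComplexManifold.exists_average_eq_affine (domain s 1).isOpen
    (fun j ↦ realIncl s (b j)) hsmooth (fun z _ ↦ X.liftExt_comp_mulI hη z)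
    (fun z hz ↦ X.localDdc_liftExt hη hddc hsmooth hz)
    (fun z j ↦ by rw [← hβ j, X.liftExt_add_realIncl])
    (d := diagVec s) (e := lineVec s) (by
      convert hrange (fun _ ↦ 1, 0) using 1
      simp [realIncl_apply, diagVec]) (by
      convert hrange (0, fun _ ↦ 1) using 1
      simp [realIncl_apply, lineVec]
      rfl) (by
      convert hrange (0, fun _ ↦ Complex.I) using 1
      refine Prod.ext (funext fun i ↦ ?_) (funext fun j ↦ ?_) <;> simp [realIncl_apply, lineVec])
    (fun t ht θ ↦ by
      simp only [← map_smul, ← map_sum]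
      exact diag_add_realIncl_mem ht _)
  refine ⟨n, b, A, B, fun t ht ↦ ?_⟩
  rw [← h t ht]
  simp only [map_sum, map_smul]

/-- By cocompactness, the component along `ℂ` of a Hermitian metric is bounded below by a multiple
of `∏ Im xᵢ`: the quotient of the two is invariant under `U ⋉ 𝓞 K`. -/
lemma Datum.exists_le_fundamentalForm (X : Datum K s 1)
    (g : HermitianMetric (Model s 1) X.Manifold) : ∃ c : ℝ, 0 < c ∧ ∀ z ∈ domain s 1,
      c * ∏ i, (z.1 i).im ≤
        X.liftExt g.fundamentalForm z ![lineVec s, Complex.I • lineVec s] := by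
  let h : Model s 1 → ℝ := fun z ↦
    X.liftExt g.fundamentalForm z ![lineVec s, Complex.I • lineVec s]
  have hprod : ∀ z ∈ domain s 1, 0 < ∏ i, (z.1 i).im := fun z hz ↦
    Finset.prod_pos fun i _ ↦ hz i
  have hne : lineVec s ≠ 0 := fun h0 ↦ by
    have := congrFun (congrArg Prod.snd h0) 0
    simp [lineVec] at this
  have hpos : ∀ z ∈ domain s 1, 0 < h z := fun z hz ↦ by
    simp only [h]
    rw [X.liftExt_of_mem _ hz]
    exact X.lift_fundamentalForm_pos g ⟨z, hz⟩ hne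
  have hinv : ∀ (a : X.Γ), ∀ z ∈ domain s 1,
      h (X.affine a z) / ∏ i, ((X.affine a z).1 i).im = h z / ∏ i, (z.1 i).im := by
    intro a z hz
    have h1 : h z = ‖X.τ 0 ((a.unit : 𝓞 K) : K)‖ ^ 2 * h (X.affine a z) := by
      have h2 : X.linearPart a (lineVec s) = X.τ 0 ((a.unit : 𝓞 K) : K) • lineVec s := by
        rw [X.linearPart_apply]
        refine Prod.ext (funext fun i ↦ ?_) (funext fun j ↦ ?_)
        · simp [lineVec]
        · simp [lineVec, Fin.fin_one_eq_zero j]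
      simp only [h]
      rw [← smul_eq_mul, ← alternating_smul_lineVec_I, X.liftExt_affine _ a z, ← h2, ← map_smul,
        ContinuousAlternatingMap.compContinuousLinearMap_apply]
      congr 1
      ext i : 1
      fin_cases i <;> rfl
    have h3 : ∏ i, ((X.affine a z).1 i).im =
        (∏ i, X.σ i ((a.unit : 𝓞 K) : K)) * ∏ i, (z.1 i).im := by
      rw [← Finset.prod_mul_distrib]
      refine Finset.prod_congr rfl fun i _ ↦ ?_
      simp [Datum.affine]
    have h4 := X.prod_unit a.unit_mem
    rw [Fin.prod_univ_one] at h4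
    have h5 := (hprod z hz).ne'
    have h6 := left_ne_zero_of_mul_eq_one h4
    rw [h1, h3, div_eq_div_iff (mul_ne_zero h6 h5) h5]
    linear_combination (-(h (X.affine a z) * ∏ i, (z.1 i).im)) * h4
  -- the invariant quotient attains its minimum on a compact set that meets every orbit
  obtain ⟨C, hC, hcov⟩ := X.exists_isCompact_smul_mem
  have hcont : Continuous fun p : domain s 1 ↦
      h p / ∏ i, ((p : Model s 1).1 i).im := by
    refine Continuous.div ?_ ?_ fun p ↦ (hprod p p.2).ne'
    · have h1 : ContinuousOn h (domain s 1) := (ContinuousAlternatingMap.apply ℝ (Model s 1) ℝ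
        ![lineVec s, Complex.I • lineVec s]).continuous.comp_continuousOn
          (X.contDiffOn_liftExt_fundamentalForm g).continuousOn
      exact h1.comp_continuous continuous_subtype_val fun p ↦ p.2
    · refine continuous_finsetProd _ fun i _ ↦ Complex.continuous_im.comp ?_
      exact (continuous_apply i).comp (continuous_fst.comp continuous_subtype_val)
  have hCne : C.Nonempty := ⟨_, (hcov (basePoint s)).choose_spec⟩
  obtain ⟨p₀, -, hp₀⟩ := hC.exists_isMinOn hCne hcont.continuousOn
  refine ⟨_, div_pos (hpos p₀ p₀.2) (hprod p₀ p₀.2), fun z hz ↦ ?_⟩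
  obtain ⟨a, ha⟩ := hcov ⟨z, hz⟩
  rw [← le_div_iff₀ (hprod z hz)]
  exact (hp₀ ha).trans_eq (hinv a z hz)

/-- For an SKT metric, the averaged component along `ℂ` would grow at least like `t ^ s` along the
diagonal and be affine at the same time. -/
theorem Datum.not_isSKT (hs : 2 ≤ s) (X : Datum K s 1)
    (g : HermitianMetric (Model s 1) X.Manifold) : ¬ g.IsSKT := fun hg ↦ by
  have hsmooth := X.contDiffOn_liftExt_fundamentalForm g
  obtain ⟨n, b, A, B, h⟩ := X.exists_average_eq_affine (fundamentalForm_isOneOne g) hg hsmooth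
  obtain ⟨c, hc, hle⟩ := X.exists_le_fundamentalForm g
  refine hc.ne' (eq_zero_of_mul_pow_le hs hc.le (a := A) (b := B) fun t ht ↦ ?_)
  rw [← smul_eq_mul t B, ← h t ht]
  have hvol : (volume : Measure (Fin (n + 1) → ℝ)).real (Icc 0 1) = 1 := by
    simp [Measure.real, Real.volume_Icc_pi]
  have hconst : ∫ _ in Icc (0 : Fin (n + 1) → ℝ) 1, c * t ^ s = c * t ^ s := by
    rw [setIntegral_const, hvol, one_smul]
  rw [← hconst]
  refine setIntegral_mono_on (continuousOn_const.integrableOn_compact isCompact_Icc)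
    (Continuous.continuousOn ?_ |>.integrableOn_compact isCompact_Icc) measurableSet_Icc
    fun θ _ ↦ ?_
  · have h1 : ContinuousOn (fun z ↦ X.liftExt g.fundamentalForm z
        ![lineVec s, Complex.I • lineVec s]) (domain s 1) :=
      (ContinuousAlternatingMap.apply ℝ (Model s 1) ℝ
        ![lineVec s, Complex.I • lineVec s]).continuous.comp_continuousOn hsmooth.continuousOn
    exact h1.comp_continuous (by fun_prop) fun θ ↦ diag_add_realIncl_mem ht _
  · refine le_trans (le_of_eq ?_) (hle _ (diag_add_realIncl_mem ht _))
    rw [diag_add_realIncl]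
    simp

/-- The component along `ℂ` of a left-invariant form is a constant times `∏ Im xᵢ`, since the norm of
the eigenvalue of `φ(r)` on `ℂ` is `exp (-(r₁ + ⋯ + r_s) / 2)`. -/
lemma IsLeftInvariant.liftExt_diag {X : Datum K s 1} {c : Fin s → ℝ}
    {η : DForm (Model s 1) X.Manifold ℂ 2} (h : IsLeftInvariant X c η) {z : Model s 1}
    (hz : z ∈ domain s 1) : X.liftExt η z ![lineVec s, Complex.I • lineVec s] =
      (∏ i, (z.1 i).im) •
        X.liftExt η (basePoint s) ![lineVec s, Complex.I • lineVec s] := by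
  set r : Fin s → ℝ := -fun i ↦ Real.log (z.1 i).im with hr
  have h1 : solvLinear c r (lineVec s) = solvChar c r • lineVec s := by
    rw [solvLinear_apply]
    refine Prod.ext (funext fun i ↦ ?_) (funext fun j ↦ ?_) <;> simp [lineVec]
  have h2 : ‖solvChar c r‖ ^ 2 = ∏ i, (z.1 i).im := by
    rw [norm_solvChar_sq, ← Finset.sum_neg_distrib, Real.exp_sum]
    refine Finset.prod_congr rfl fun i _ ↦ ?_
    rw [hr, Pi.neg_apply, neg_neg, Real.exp_log (hz i)]
  rw [h.liftExt_apply hz, ← h2, ← alternating_smul_lineVec_I, ← h1, ← map_smul]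
  congr 1
  ext i : 1
  fin_cases i <;> rfl

/-- A left-invariant `ddᶜ`-closed `(1,1)`-form has no component along `ℂ`: this component is
`t ^ s` times a constant along the diagonal, and it is affine there. -/
theorem IsLeftInvariant.lift_eq_zero (hs : 2 ≤ s) {X : Datum K s 1} {c : Fin s → ℝ}
    {η : DForm (Model s 1) X.Manifold ℂ 2} (hη : η.IsOneOne) (hddc : η.ddc = 0)
    (h : IsLeftInvariant X c η) (p : domain s 1) (z z' : Fin 1 → ℂ) :
    X.lift η p ![((0, z) : Model s 1), ((0, z') : Model s 1)] = 0 := by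
  obtain ⟨n, b, A, B, hAB⟩ := X.exists_average_eq_affine hη hddc h.contDiffOn_liftExt
  set C := X.liftExt η (basePoint s) ![lineVec s, Complex.I • lineVec s] with hCdef
  have hvol : (volume : Measure (Fin (n + 1) → ℝ)).real (Icc 0 1) = 1 := by
    simp [Measure.real, Real.volume_Icc_pi]
  have hC : ∀ t : ℝ, 0 < t → t ^ s • C = A + t • B := fun t ht ↦ by
    rw [← hAB t ht]
    have hx : ∀ x, X.liftExt η (t • Complex.I • diagVec s + realIncl s x)
        ![lineVec s, Complex.I • lineVec s] = t ^ s • C := fun x ↦ by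
      rw [h.liftExt_diag (diag_add_realIncl_mem ht x), diag_add_realIncl]
      simp [hCdef]
    simp only [hx]
    rw [setIntegral_const, hvol, one_smul]
  have hC0 : C = 0 := norm_eq_zero.1 <| eq_zero_of_mul_pow_le hs (norm_nonneg C)
    (a := ‖A‖) (b := ‖B‖) fun t ht ↦ by
      have h1 := congrArg norm (hC t ht)
      rw [norm_smul, norm_pow, Real.norm_of_nonneg ht.le] at h1
      rw [mul_comm, h1]
      refine (norm_add_le _ _).trans_eq ?_
      rw [norm_smul, Real.norm_of_nonneg ht.le]
  have hline : ∀ z : Fin 1 → ℂ, ((0, z) : Model s 1) = z 0 • lineVec s := fun z ↦ by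
    refine Prod.ext (funext fun i ↦ ?_) (funext fun j ↦ ?_)
    · simp [lineVec]
    · simp [lineVec, Fin.fin_one_eq_zero j]
  rw [hline z, hline z']
  have h2 := alternating_smul_lineVec (X.liftExt η p) (z 0) (z' 0)
  rw [h.liftExt_diag p.2, ← hCdef, hC0, smul_zero, smul_zero, X.liftExt_of_mem η p.2] at h2
  exact h2

end Component

end OeljeklausToma

end

theorem mainTheorem9 {K : Type*} [Field K] [NumberField K] {s : ℕ} (hs : 2 ≤ s)
    (X : OeljeklausToma.Datum K s 1) :
    (¬ ∃ g : ComplexManifold.HermitianMetric (OeljeklausToma.Model s 1) X.Manifold, g.IsSKT) ∧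
    ∀ (c : Fin s → ℝ) (η : ComplexManifold.DForm (OeljeklausToma.Model s 1) X.Manifold ℂ 2),
      η.IsOneOne → η.ddc = 0 → OeljeklausToma.IsLeftInvariant X c η →
      ∀ (p : OeljeklausToma.domain s 1) (z z' : Fin 1 → ℂ),
        X.lift η p ![((0, z) : OeljeklausToma.Model s 1), ((0, z') : OeljeklausToma.Model s 1)] = 0 :=
  ⟨fun ⟨g, hg⟩ ↦ X.not_isSKT hs g hg, fun _ _ h11 hddc hinv p z z' ↦
    hinv.lift_eq_zero hs h11 hddc p z z'⟩
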